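/- Let $D\ge 2$ be an integer and $\mathcal F_D=\big(D^{-1/2}e^{-2\pi i jl/D}\big)_{0\le j,l<D}$. For $k\ge 1$ let $\mathcal H_{D^k}=(\mathbb C^D)^{\otimes k}$ and let $(e_\epsilon)_{0\le\epsilon<D}$ be the standard basis of $\mathbb C^D$. Let $W_{D^k}$ be the Walsh transform $$W_{D^k}(v^{(1)}\otimes\cdots\otimes v^{(k)})=\mathcal F_Dv^{(k)}\otimes\cdots\otimes\mathcal F_Dv^{(1)},$$ and let $$B_k=W_{D^k}^{-1}\,\mathrm{diag}(W_{D^{k-1}},\dots,W_{D^{k-1}})\qquad(D\text{ blocks})$$ be the Walsh-quantized $D$-baker's map, written in the basis $e_{\epsilon_1}\otimes\cdots\otimes e_{\epsilon_k}$ ordered by $j\equiv\epsilon_1\cdots\epsilon_k\in\{0,\dots,D^k-1\}$. Let $\Sigma=\{0,\dots,D-1\}^{\mathbb N_*}\times\{0,\dots,D-1\}^{\mathbb N_*}$ with the product topology. A point $\epsilon'\cdot\epsilon\in\Sigma$ codes the point $(q,p)=(0.\epsilon_1\epsilon_2\ldots,\,0.\epsilon_1'\epsilon_2'\ldots)$ (base-$D$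 expansions) of the torus $\mathbb T^2=(\mathbb R/\mathbb Z)^2$. Lebesgue measure on $\Sigma$ is the measure under which all symbols are independent and uniform. For $0\le\ell\le k$ and $\psi\in\mathcal H_{D^k}$ with $\|\psi\|=1$, the Walsh-Husimi measure $WH^{k,\ell}_\psi$ is the probability measure on $\mathbb T^2$ (or on $\Sigma$) whose density with respect to Lebesgue measure at the point coded by $\epsilon'\cdot\epsilon$ is $$D^k\,\big|\langle\psi,\;e_{\epsilon_1}\otimes\cdots\otimes e_{\epsilon_\ell}\otimes\mathcal F_D^*e_{\epsilon'_{k-\ell}}\otimes\cdots\otimes\mathcal F_D^*e_{\epsilon'_1}\rangle\big|^2 .$$ A semiclassical measure is a probability measure $\mu$ on $\mathbb T^2$ (resp. on $\Sigma$) that is the weak limit of $WH^{k_j,\ell_j}_{\psi_j}$ as $j\to\infty$, for some strictly increasing sequence $(k_j)$, some $0\le\ell_j\le k_j$ with $\ell_j\to\infty$ and $k_j-\ell_j\to\infty$, and some normalized eigenstates $\psi_j\in\mathcal H_{D^{k_j}}$ of $B_{k_j}$. **Theorem.** Let $\mu$ be a semiclassical measure of the Walsh-quantized $D$-baker, on $\mathbb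 T^2$ or on $\Sigma$. Then $\mu$ can be decomposed as $$\mu=\beta_{pp}\,\mu_{pp}+\beta_{sc}\,\mu_{sc}+\beta_{Leb}\,\mu_{Leb},\qquad \beta_{pp},\beta_{sc},\beta_{Leb}\ge 0,\quad \beta_{pp}+\beta_{sc}+\beta_{Leb}=1,$$ where $\mu_{pp}$ is a pure point probability measure (carried by a countable set), $\mu_{sc}$ is a singular continuous probability measure (without atoms and singular to Lebesgue measure), and $\mu_{Leb}$ is Lebesgue measure. In every such decomposition $$\beta_{pp}\le\beta_{Leb}.$$ -/

import Mathlib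

open MeasureTheory Filter Topology
open scoped ENNReal Matrix

noncomputable section

namespace WalshBaker

/-! ### Classical phase spaces -/

/-- The symbolic phase space `Σ = Σ₊ × Σ₊`. A point `ε' · ε` is the pair `(ε', ε)`; the symbols
are numbered from `0`, so `x.2 i` is `ε_{i+1}` and `x.1 i` is `ε'_{i+1}`. -/
abbrev SymbolSpace (D : ℕ) : Type := (ℕ → Fin D) × (ℕ → Fin D)

/-- The torus `𝕋² = (ℝ/ℤ)²`, with coordinates `(q, p)`. Its `volume` is Lebesgue measure, of
total mass `1`. -/
abbrev Torus : Type := UnitAddCircle × UnitAddCircle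

/-- The uniform measure on the one-sided sequences: the symbols are independent and uniform. -/
def uniformSeq (D : ℕ) [NeZero D] : Measure (ℕ → Fin D) :=
  Measure.infinitePi fun _ : ℕ => (PMF.uniformOfFintype (Fin D)).toMeasure

/-- Lebesgue measure seen on `Σ`: a cylinder `[ε' · ε]` of lengths `n'`, `n` has mass
`D ^ (-(n' + n))`. -/
def symbolLebesgue (D : ℕ) [NeZero D] : Measure (SymbolSpace D) :=
  (uniformSeq D).prod (uniformSeq D)

/-- The `D`-nary digits of a point of `ℝ/ℤ`, taken from its representative in `[0, 1)`. -/
def circleDigits (D : ℕ) [NeZero D] (t : UnitAddCircle) : ℕ → Fin D :=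
  Real.digits ((AddCircle.equivIco (1 : ℝ) 0 t : Set.Ico (0 : ℝ) (0 + 1)) : ℝ) D

/-- The `D`-nary coding of the torus: `(q, p)` is sent to `ε' · ε` with `q = 0.ε₁ε₂…` and
`p = 0.ε'₁ε'₂…`. -/
def torusCode (D : ℕ) [NeZero D] (x : Torus) : SymbolSpace D :=
  (circleDigits D x.2, circleDigits D x.1)

/-! ### Walsh quantum mechanics -/

/-- The quantum space `(ℂ^D)^{⊗ k}`, in the orthonormal basis of position eigenstates
`e_{ε₁} ⊗ ⋯ ⊗ e_{ε_k}`. -/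
abbrev State (D k : ℕ) : Type := EuclideanSpace ℂ (Fin k → Fin D)

/-- The product state `v⁽¹⁾ ⊗ ⋯ ⊗ v⁽ᵏ⁾`. -/
def productState {D k : ℕ} (v : Fin k → Fin D → ℂ) : State D k :=
  WithLp.toLp 2 fun α => ∏ i, v i (α i)

/-- The discrete Fourier transform on `ℂ^D`, with entries `D^{-1/2} e^{-2πi jl/D}`. -/
def fourierMatrix (D : ℕ) : Matrix (Fin D) (Fin D) ℂ :=
  Matrix.of fun j l =>
    ((Real.sqrt D : ℝ) : ℂ)⁻¹ *
      Complex.exp (-(2 * Real.pi * Complex.I * ((j : ℕ) : ℂ) * ((l : ℕ) : ℂ) / (D : ℂ)))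

/-- The Walsh transform: the matrix of
`v⁽¹⁾ ⊗ ⋯ ⊗ v⁽ᵏ⁾ ↦ F v⁽ᵏ⁾ ⊗ F v⁽ᵏ⁻¹⁾ ⊗ ⋯ ⊗ F v⁽¹⁾` in the position basis. -/
def walsh (D k : ℕ) : Matrix (Fin k → Fin D) (Fin k → Fin D) ℂ :=
  Matrix.of fun α ε => ∏ i, fourierMatrix D (α i) (ε (Fin.rev i))

/-- The block diagonal matrix with `D` diagonal blocks `W_{D^n}`, the block being selected by the
first symbol (the most significant digit of the position). -/
def walshBlocks (D n : ℕ) : Matrix (Fin (n + 1) → Fin D) (Fin (n + 1) → Fin D) ℂ :=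
  Matrix.of fun α ε => if α 0 = ε 0 then walsh D n (Fin.tail α) (Fin.tail ε) else 0

/-- The Walsh-quantized baker's map `B_k = W_{D^k}⁻¹ diag(W_{D^{k-1}}, …, W_{D^{k-1}})`, `k ≥ 1`.
(The value at `k = 0` is a convention that plays no role.) -/
def quantumBaker (D : ℕ) : (k : ℕ) → Matrix (Fin k → Fin D) (Fin k → Fin D) ℂ
  | 0 => 1
  | n + 1 => (walsh D (n + 1))⁻¹ * walshBlocks D n

/-- `ψ` is a normalized eigenstate of the quantum baker `B_k`. -/
def IsEigenstate {D k : ℕ} (ψ : State D k) : Prop :=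
  ‖ψ‖ = 1 ∧ ∃ z : ℂ, quantumBaker D k *ᵥ ψ.ofLp = z • ψ.ofLp

/-- The Walsh coherent state
`e_{ε₁} ⊗ ⋯ ⊗ e_{ε_ℓ} ⊗ F* e_{ε'_{k-ℓ}} ⊗ ⋯ ⊗ F* e_{ε'₁}` (`ℓ ≤ k`) of the quantum rectangle
`[ε'₁ … ε'_{k-ℓ} · ε₁ … ε_ℓ]` that contains the point `x = ε' · ε` of `Σ`. -/
def coherentState {D : ℕ} (k l : ℕ) (x : SymbolSpace D) : State D k :=
  productState fun i =>
    if (i : ℕ) < l then Pi.single (x.2 i) 1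
    else (fourierMatrix D)ᴴ *ᵥ Pi.single (x.1 (Fin.rev i)) 1

/-- The Walsh-Husimi function `D^k |⟨ψ | ε' · ε⟩|²`, as a function on `Σ`. It is constant on each
quantum rectangle. -/
def husimi {D k : ℕ} (l : ℕ) (ψ : State D k) (x : SymbolSpace D) : ℝ :=
  (D : ℝ) ^ k * ‖inner ℂ ψ (coherentState k l x)‖ ^ 2

/-- The Walsh-Husimi measure on `Σ`. -/
def husimiMeasureSymbol {D k : ℕ} [NeZero D] (l : ℕ) (ψ : State D k) :
    Measure (SymbolSpace D) :=
  (symbolLebesgue D).withDensity fun x => ENNReal.ofReal (husimi l ψ x)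

/-- The Walsh-Husimi measure on the torus. -/
def husimiMeasureTorus {D k : ℕ} [NeZero D] (l : ℕ) (ψ : State D k) : Measure Torus :=
  (volume : Measure Torus).withDensity fun x => ENNReal.ofReal (husimi l ψ (torusCode D x))

/-! ### Semiclassical measures -/

/-- Weak convergence of a sequence of measures on a compact space. -/
def WeaklyConverges {X : Type} [TopologicalSpace X] [MeasurableSpace X]
    (ν : ℕ → Measure X) (μ : Measure X) : Prop :=
  ∀ f : C(X, ℝ), Tendsto (fun j => ∫ x, f x ∂(ν j)) atTop (𝓝 (∫ x, f x ∂μ))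

/-- `(k j)`, `(l j)`, `(ψ j)` is a semiclassical sequence of eigenstates: `k → ∞`, `ψ j` is a
normalized eigenstate of `B_{k j}`, and the indices `l j ≤ k j` of the Husimi representations
satisfy `l → ∞` and `k - l → ∞`. -/
structure IsSemiclassicalSequence {D : ℕ} (k l : ℕ → ℕ) (ψ : ∀ j, State D (k j)) : Prop where
  strictMono : StrictMono k
  le : ∀ j, l j ≤ k j
  tendsto_l : Tendsto l atTop atTop
  tendsto_sub : Tendsto (fun j => k j - l j) atTop atTop
  eigenstate : ∀ j, IsEigenstate (ψ j)

/-- Semiclassical measures of the Walsh-quantized `D`-baker, as probability measures on `Σ`. -/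
def IsSemiclassicalMeasureSymbol (D : ℕ) [NeZero D] (μ : Measure (SymbolSpace D)) : Prop :=
  IsProbabilityMeasure μ ∧
    ∃ (k l : ℕ → ℕ) (ψ : ∀ j, State D (k j)), IsSemiclassicalSequence k l ψ ∧
      WeaklyConverges (fun j => husimiMeasureSymbol (l j) (ψ j)) μ

/-- Semiclassical measures of the Walsh-quantized `D`-baker, as probability measures on the
torus. -/
def IsSemiclassicalMeasureTorus (D : ℕ) [NeZero D] (μ : Measure Torus) : Prop :=
  IsProbabilityMeasure μ ∧
    ∃ (k l : ℕ → ℕ) (ψ : ∀ j, State D (k j)), IsSemiclassicalSequence k l ψ ∧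
      WeaklyConverges (fun j => husimiMeasureTorus (l j) (ψ j)) μ

/-! ### The decomposition of a measure -/

/-- `μ = βpp μpp + βsc μsc + βLeb leb` with nonnegative weights of sum `1`, a pure point
probability measure `μpp` and a singular continuous probability measure `μsc`; here `leb` is the
Lebesgue measure. -/
structure IsDecomposition {X : Type} [MeasurableSpace X] (leb μ μpp μsc : Measure X)
    (βpp βsc βLeb : ℝ) : Prop where
  pp_nonneg : 0 ≤ βpp
  sc_nonneg : 0 ≤ βsc
  leb_nonneg : 0 ≤ βLeb
  sum_eq_one : βpp + βsc + βLeb = 1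
  prob_pp : IsProbabilityMeasure μpp
  prob_sc : IsProbabilityMeasure μsc
  purePoint : ∃ S : Set X, S.Countable ∧ μpp Sᶜ = 0
  continuous : ∀ x, μsc {x} = 0
  singular : μsc ⟂ₘ leb
  eq : μ = ENNReal.ofReal βpp • μpp + ENNReal.ofReal βsc • μsc + ENNReal.ofReal βLeb • leb

end WalshBaker

end

open MeasureTheory Filter Topology
open scoped ENNReal Matrix

noncomputable section

namespace WalshBaker

/-! ### The Fourier matrix and its tensor powers -/

/-! On product states the baker is a twisted shift, v₁ ⊗ ⋯ ⊗ v_k ↦ v₂ ⊗ ⋯ ⊗ v_k ⊗ F* v₁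
(`quantumBaker_succ`). This has two consequences for an eigenstate ψ. First, coherent states for all
ℓ are images of basis states under powers of the baker, so every Husimi density is |ψ(β)|², up to
the factor D^k, at the word β read off the point (`IsEigenstate.norm_inner_coherentState`); this law
on words is shift invariant on short cylinders. Second, the k-th power of the baker is (F*)^{⊗k}, so
|ψ| is unchanged when all slots are Fourier transformed (`IsEigenstate.norm_tensorPower_mulVec`).

The second fact yields an uncertainty principle. Transforming the slots outside a block is unitary,
hence invisible to the law of the block, so this law is also the law after a transform of the block
alone (`sum_norm_sq_block`). If the earlier symbols nearly determine the block, the state there is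
nearly a basis vector and its transform is nearly flat: every word of the block receives almost
D^{-m} of the mass (`IsEigenstate.wordProb_wordAt_ge`).

In the limit, let ρ be the law of the one-sided sequence and C a finite set. Sequences that agree
with C for a long time lie in C up to small mass, so on them the past predicts the next m symbols.
Invariance then gives ρ ≥ ρ(C) · Lebesgue, also for countable C (`IsDelocalized.smul_countable_le`).
Ergodicity of the Bernoulli shift makes the absolutely continuous part of ρ a multiple of Lebesgue
measure. Both facts pass to Σ because every one-sided reading of μ has the same law. The inequality
of the weights follows by evaluation on a set of full Lebesgue measure that is null for both
singular parts (`IsBalanced.pp_le_leb`). A semiclassical measure on the torus is lifted to Σ by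
compactness, and the conclusion is projected back. -/

lemma fourierMatrix_apply_eq (D : ℕ) (j l : Fin D) :
    fourierMatrix D j l = ((Real.sqrt D : ℝ) : ℂ)⁻¹ *
      (Complex.exp (2 * Real.pi * Complex.I / D))⁻¹ ^ ((j : ℕ) * (l : ℕ)) := by
  rw [fourierMatrix, Matrix.of_apply, ← Complex.exp_neg, ← Complex.exp_nat_mul]
  congr 2
  push_cast
  ring

lemma isPrimitiveRoot_inv_exp (D : ℕ) [NeZero D] :
    IsPrimitiveRoot (Complex.exp (2 * Real.pi * Complex.I / D))⁻¹ D :=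
  (Complex.isPrimitiveRoot_exp D (NeZero.ne D)).inv

lemma norm_fourierMatrix_sq (D : ℕ) [NeZero D] (j l : Fin D) :
    ‖fourierMatrix D j l‖ ^ 2 = (D : ℝ)⁻¹ := by
  rw [fourierMatrix_apply_eq, norm_mul, norm_pow,
    (isPrimitiveRoot_inv_exp D).norm'_eq_one (NeZero.ne D), one_pow, mul_one, norm_inv,
    Complex.norm_real, inv_pow, Real.norm_eq_abs, sq_abs, Real.sq_sqrt (Nat.cast_nonneg D)]

lemma fourierMatrix_mul_conjTranspose (D : ℕ) [NeZero D] :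
    fourierMatrix D * (fourierMatrix D)ᴴ = 1 := by
  have hD : (D : ℂ) ≠ 0 := Nat.cast_ne_zero.mpr (NeZero.ne D)
  set ζ : ℂ := (Complex.exp (2 * Real.pi * Complex.I / D))⁻¹ with hζ
  have hprim : IsPrimitiveRoot ζ D := isPrimitiveRoot_inv_exp D
  clear_value ζ
  have hζ0 : ζ ≠ 0 := hprim.ne_zero (NeZero.ne D)
  have hstar : star ζ = ζ⁻¹ := by
    have h1 : ‖ζ‖ = 1 := hprim.norm'_eq_one (NeZero.ne D)
    rw [Complex.inv_def, Complex.normSq_eq_norm_sq, h1]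
    simp
  have hsq : ((Real.sqrt D : ℝ) : ℂ)⁻¹ * ((Real.sqrt D : ℝ) : ℂ)⁻¹ = (D : ℂ)⁻¹ := by
    rw [← mul_inv, ← Complex.ofReal_mul, Real.mul_self_sqrt (Nat.cast_nonneg D)]
    simp
  ext i j
  rw [Matrix.mul_apply]
  have hterm : ∀ l : Fin D, fourierMatrix D i l * (fourierMatrix D)ᴴ l j =
      (D : ℂ)⁻¹ * (ζ ^ (i : ℕ) * ζ⁻¹ ^ (j : ℕ)) ^ (l : ℕ) := by
    intro l
    rw [Matrix.conjTranspose_apply, fourierMatrix_apply_eq, fourierMatrix_apply_eq, ← hζ,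
      star_mul', star_pow, hstar, star_inv₀, Complex.star_def, Complex.conj_ofReal, ← hsq, mul_pow,
      pow_mul, pow_mul]
    ring
  rw [Finset.sum_congr rfl fun l _ => hterm l, ← Finset.mul_sum,
    Fin.sum_univ_eq_sum_range (fun l => (ζ ^ (i : ℕ) * ζ⁻¹ ^ (j : ℕ)) ^ l) D]
  rcases eq_or_ne i j with rfl | hij
  · rw [← mul_pow, mul_inv_cancel₀ hζ0]
    simp [hD]
  · rw [Matrix.one_apply_ne hij]
    have hne : ζ ^ (i : ℕ) * ζ⁻¹ ^ (j : ℕ) - 1 ≠ 0 := by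
      intro h
      apply hij
      have h1 : ζ ^ (i : ℕ) = ζ ^ (j : ℕ) := by
        rw [sub_eq_zero, inv_pow, mul_inv_eq_one₀ (pow_ne_zero _ hζ0)] at h
        exact h
      exact Fin.ext (hprim.pow_inj i.2 j.2 h1)
    have hz : (∑ l ∈ Finset.range D, (ζ ^ (i : ℕ) * ζ⁻¹ ^ (j : ℕ)) ^ l) = 0 := by
      have := geom_sum_mul (ζ ^ (i : ℕ) * ζ⁻¹ ^ (j : ℕ)) D
      rw [mul_pow, ← pow_mul, ← pow_mul, mul_comm (i : ℕ), mul_comm (j : ℕ), pow_mul, pow_mul,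
        hprim.pow_eq_one, hprim.inv.pow_eq_one, one_pow, one_pow, one_mul, sub_self] at this
      exact (mul_eq_zero.mp this).resolve_right hne
    rw [hz, mul_zero]

lemma conjTranspose_mul_fourierMatrix (D : ℕ) [NeZero D] :
    (fourierMatrix D)ᴴ * fourierMatrix D = 1 :=
  mul_eq_one_comm.mp (fourierMatrix_mul_conjTranspose D)

/-- The tensor power of a matrix, in the product basis. -/
def tensorPower (ι : Type*) [Fintype ι] {D : ℕ} (A : Matrix (Fin D) (Fin D) ℂ) :
    Matrix (ι → Fin D) (ι → Fin D) ℂ :=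
  Matrix.of fun α β => ∏ i, A (α i) (β i)

section tensorPower
variable {ι : Type*} [Fintype ι] {D : ℕ} (A B : Matrix (Fin D) (Fin D) ℂ)

lemma tensorPower_mul [DecidableEq ι] :
    tensorPower ι A * tensorPower ι B = tensorPower ι (A * B) := by
  ext α β
  simp only [Matrix.mul_apply, tensorPower, Matrix.of_apply, ← Finset.prod_mul_distrib]
  rw [Fintype.prod_sum]

lemma tensorPower_one [DecidableEq ι] : tensorPower ι (1 : Matrix (Fin D) (Fin D) ℂ) = 1 := by
  ext α β
  simp only [tensorPower, Matrix.of_apply, Matrix.one_apply]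
  rw [Fintype.prod_ite_zero]
  simp [funext_iff]

lemma tensorPower_conjTranspose : (tensorPower ι A)ᴴ = tensorPower ι Aᴴ := by
  ext α β
  simp [tensorPower, Matrix.conjTranspose_apply]

end tensorPower

lemma sum_norm_sq_eq_dotProduct {p : Type*} [Fintype p] (y : p → ℂ) :
    ((∑ i, ‖y i‖ ^ 2 : ℝ) : ℂ) = star y ⬝ᵥ y := by
  push_cast
  refine Finset.sum_congr rfl fun i _ => ?_
  rw [Pi.star_apply, Complex.star_def, Complex.conj_mul']

lemma sum_norm_mulVec_sq {m n : Type*} [Fintype m] [Fintype n] [DecidableEq n]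
    {U : Matrix m n ℂ} (hU : Uᴴ * U = 1) (x : n → ℂ) :
    ∑ i, ‖(U *ᵥ x) i‖ ^ 2 = ∑ i, ‖x i‖ ^ 2 := by
  apply Complex.ofReal_injective
  rw [sum_norm_sq_eq_dotProduct, sum_norm_sq_eq_dotProduct, Matrix.star_mulVec,
    Matrix.dotProduct_mulVec, Matrix.vecMul_vecMul, hU,
    Matrix.vecMul_one]

/-! ### The baker as a twisted shift -/

lemma walsh_mul_conjTranspose (D k : ℕ) [NeZero D] : walsh D k * (walsh D k)ᴴ = 1 := by
  have h := congrArg (fun M => tensorPower (Fin k) M) (fourierMatrix_mul_conjTranspose D)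
  simp only [← tensorPower_mul, tensorPower_one, ← tensorPower_conjTranspose] at h
  rw [← h]
  ext α β
  simp only [Matrix.mul_apply, Matrix.conjTranspose_apply]
  -- The Walsh matrix is the tensor power of F up to reversal of the slots of its column index; the
  -- reversal only reindexes the inner sum.
  exact Equiv.sum_comp (Equiv.arrowCongr Fin.revPerm (Equiv.refl (Fin D)))
    fun ε : Fin k → Fin D => tensorPower (Fin k) (fourierMatrix D) α ε *
      star (tensorPower (Fin k) (fourierMatrix D) β ε)

/-- The twisted shift `v⁽¹⁾ ⊗ ⋯ ⊗ v⁽ᵏ⁾ ↦ v⁽²⁾ ⊗ ⋯ ⊗ v⁽ᵏ⁾ ⊗ F* v⁽¹⁾`. -/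
def twistedShift (D n : ℕ) : Matrix (Fin (n + 1) → Fin D) (Fin (n + 1) → Fin D) ℂ :=
  Matrix.of fun α β =>
    if Fin.init α = Fin.tail β then (fourierMatrix D)ᴴ (α (Fin.last n)) (β 0) else 0

lemma sum_snoc {D n : ℕ} {M : Type*} [AddCommMonoid M] (f : (Fin (n + 1) → Fin D) → M) :
    ∑ α, f α = ∑ r : Fin n → Fin D, ∑ a, f (Fin.snoc (α := fun _ => Fin D) r a) := by
  rw [← Equiv.sum_comp (Fin.snocEquiv fun _ => Fin D), Fintype.sum_prod_type_right]
  rfl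

lemma sum_cons {D n : ℕ} {M : Type*} [AddCommMonoid M] (f : (Fin (n + 1) → Fin D) → M) :
    ∑ α, f α = ∑ r : Fin n → Fin D, ∑ a, f (Fin.cons (α := fun _ => Fin D) a r) := by
  rw [← Equiv.sum_comp (Fin.consEquiv fun _ => Fin D), Fintype.sum_prod_type_right]
  rfl

/-- The order reversal in W pairs the last slot of the shifted word with the first output slot.
There F meets F*, and their product 1 is the block condition γ 0 = β 0. -/
lemma walsh_mul_twistedShift (D n : ℕ) [NeZero D] :
    walsh D (n + 1) * twistedShift D n = walshBlocks D n := by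
  ext γ β
  rw [Matrix.mul_apply, sum_snoc]
  simp only [twistedShift, Matrix.of_apply, Fin.init_snoc, Fin.snoc_last]
  rw [Finset.sum_eq_single (Fin.tail β)]
  · simp only [if_true, walsh, walshBlocks, Matrix.of_apply, Fin.prod_univ_succ, Fin.rev_zero,
      Fin.snoc_last, Fin.rev_succ, Fin.snoc_castSucc]
    have h := congrFun (congrFun (fourierMatrix_mul_conjTranspose D) (γ 0)) (β 0)
    rw [Matrix.mul_apply, Matrix.one_apply] at h
    calc _ = (∑ a, fourierMatrix D (γ 0) a * (fourierMatrix D)ᴴ a (β 0)) *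
          ∏ i : Fin n, fourierMatrix D (γ i.succ) (Fin.tail β i.rev) := by
          rw [Finset.sum_mul]
          exact Finset.sum_congr rfl fun a _ => by ring
      _ = _ := by
          rw [h, ite_mul, one_mul, zero_mul]
          rfl
  · intro r _ hr
    simp [hr]
  · simp

lemma quantumBaker_succ (D n : ℕ) [NeZero D] : quantumBaker D (n + 1) = twistedShift D n := by
  have h := walsh_mul_conjTranspose D (n + 1)
  have h1 : (walsh D (n + 1))⁻¹ * walsh D (n + 1) = 1 := by
    rw [Matrix.inv_eq_right_inv h]
    exact mul_eq_one_comm.mp h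
  rw [quantumBaker, ← walsh_mul_twistedShift, ← Matrix.mul_assoc, h1, Matrix.one_mul]

lemma twistedShift_conjTranspose_mul (D n : ℕ) [NeZero D] :
    (twistedShift D n)ᴴ * twistedShift D n = 1 := by
  ext β γ
  rw [Matrix.mul_apply, sum_snoc]
  simp only [twistedShift, Matrix.conjTranspose_apply, Matrix.of_apply, Fin.init_snoc,
    Fin.snoc_last]
  have h := congrFun (congrFun (fourierMatrix_mul_conjTranspose D) (β 0)) (γ 0)
  rw [Matrix.mul_apply, Matrix.one_apply] at h
  have hcons : β = γ ↔ β 0 = γ 0 ∧ Fin.tail β = Fin.tail γ := by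
    constructor
    · rintro rfl; simp
    · rintro ⟨h0, ht⟩
      rw [← Fin.cons_self_tail β, ← Fin.cons_self_tail γ, h0, ht]
  rw [Finset.sum_eq_single (Fin.tail β)]
  · simp only [if_true, star_star, mul_ite, mul_zero]
    by_cases ht : Fin.tail β = Fin.tail γ
    · simp only [ht, if_true]
      rw [Matrix.one_apply]
      simp only [hcons, ht, and_true, ← h, Matrix.conjTranspose_apply]
    · simp [ht, hcons]
  · intro r _ hr
    simp [hr]
  · simp

/-- The product state `v s ⊗ v (s + 1) ⊗ ⋯ ⊗ v (s + k - 1)` of a window of a sequence. -/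
def windowState {D : ℕ} (k : ℕ) (v : ℕ → Fin D → ℂ) (s : ℕ) : State D k :=
  productState fun i => v (s + i)

/-- Along a sequence with this twisted periodicity, the baker slides the window by one step.
Iterating it therefore needs no tensor computation. -/
lemma twistedShift_mulVec_windowState {D n : ℕ} (v : ℕ → Fin D → ℂ)
    (s : ℕ) (hv : v (s + (n + 1)) = (fourierMatrix D)ᴴ *ᵥ v s) :
    twistedShift D n *ᵥ (windowState (n + 1) v s).ofLp = (windowState (n + 1) v (s + 1)).ofLp := by
  ext α
  simp only [Matrix.mulVec, dotProduct, windowState, productState]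
  rw [sum_cons, Finset.sum_eq_single (Fin.init α)]
  · simp only [twistedShift, Matrix.of_apply, Fin.tail_cons, if_true, Fin.cons_zero,
      Fin.prod_univ_succ, Fin.cons_succ]
    rw [← Fin.prod_univ_succ (fun i : Fin (n + 1) => v (s + 1 + i) (α i)),
      Fin.prod_univ_castSucc]
    have h : v (s + 1 + (Fin.last n : ℕ)) (α (Fin.last n)) =
        ∑ b, (fourierMatrix D)ᴴ (α (Fin.last n)) b * v s b := by
      rw [Fin.val_last, show s + 1 + n = s + (n + 1) by ring, hv]
      rfl
    rw [h, Finset.mul_sum]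
    refine Finset.sum_congr rfl fun b _ => ?_
    have h2 : ∀ i : Fin n, s + ((i.succ : Fin (n + 1)) : ℕ) = s + 1 + (i.castSucc : ℕ) := by
      intro i; simp; ring
    simp only [h2, Fin.init]
    simp
    ring
  · intro r _ hr
    refine Finset.sum_eq_zero fun a _ => ?_
    simp [twistedShift, Ne.symm hr]
  · simp

/-! ### Amplitudes of eigenstates -/

lemma IsEigenstate.exists_eigenvalue {D n : ℕ} [NeZero D] {ψ : State D (n + 1)}
    (hψ : IsEigenstate ψ) :
    ∃ z : ℂ, ‖z‖ = 1 ∧ twistedShift D n *ᵥ ψ.ofLp = z • ψ.ofLp := by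
  obtain ⟨hn, z, hz⟩ := hψ
  rw [quantumBaker_succ] at hz
  refine ⟨z, ?_, hz⟩
  have h := sum_norm_mulVec_sq (twistedShift_conjTranspose_mul D n) ψ.ofLp
  have h1 : ∑ i, ‖ψ.ofLp i‖ ^ 2 = 1 := by
    rw [← EuclideanSpace.norm_sq_eq, hn, one_pow]
  rw [hz, h1] at h
  simp only [Pi.smul_apply, smul_eq_mul, norm_mul, mul_pow] at h
  rw [← Finset.mul_sum, h1, mul_one] at h
  exact (pow_eq_one_iff_of_nonneg (norm_nonneg z) two_ne_zero).mp h

/-- The orbit of amplitudes of an eigenstate along the windows of a twisted periodic sequence. -/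
lemma IsEigenstate.exists_amplitude {D n : ℕ} [NeZero D] {ψ : State D (n + 1)}
    (hψ : IsEigenstate ψ) :
    ∃ z : ℂ, ‖z‖ = 1 ∧ ∀ v : ℕ → Fin D → ℂ,
      (∀ s, v (s + (n + 1)) = (fourierMatrix D)ᴴ *ᵥ v s) → ∀ s,
      z ^ s * (star ψ.ofLp ⬝ᵥ (windowState (n + 1) v s).ofLp) =
        star ψ.ofLp ⬝ᵥ (windowState (n + 1) v 0).ofLp := by
  obtain ⟨z, hz1, hz⟩ := hψ.exists_eigenvalue
  -- The eigenvalue is conjugated because ψ stands on the antilinear side: unitarity gives ⟨ψ, w⟩ =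
  -- ⟨Bψ, Bw⟩, and Bψ = zψ.
  refine ⟨star z, by simpa using hz1, fun v hv s => ?_⟩
  induction s with
  | zero => simp
  | succ s ih =>
    rw [← ih, pow_succ, mul_assoc]
    congr 1
    rw [← twistedShift_mulVec_windowState v s (hv s), ← smul_eq_mul, ← smul_dotProduct,
      ← star_smul, ← hz, Matrix.star_mulVec, Matrix.dotProduct_mulVec, Matrix.vecMul_vecMul,
      twistedShift_conjTranspose_mul, Matrix.vecMul_one]

/-- The twisted periodic sequence of vectors that extends the basis state `e_β`. -/
def twistedSeq {D n : ℕ} (β : Fin (n + 1) → Fin D) (i : ℕ) : Fin D → ℂ :=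
  ((fourierMatrix D)ᴴ) ^ (i / (n + 1)) *ᵥ Pi.single (β ⟨i % (n + 1), Nat.mod_lt _ n.succ_pos⟩) 1

lemma twistedSeq_add {D n : ℕ} (β : Fin (n + 1) → Fin D) (s : ℕ) :
    twistedSeq β (s + (n + 1)) = (fourierMatrix D)ᴴ *ᵥ twistedSeq β s := by
  simp only [twistedSeq, Nat.add_div_right _ n.succ_pos, Nat.add_mod_right, Matrix.mulVec_mulVec,
    Nat.succ_eq_add_one, pow_succ']

lemma twistedSeq_of_lt {D n : ℕ} (β : Fin (n + 1) → Fin D) {i : ℕ} (hi : i < n + 1) :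
    twistedSeq β i = Pi.single (β ⟨i, hi⟩) 1 := by
  simp only [twistedSeq, Nat.div_eq_of_lt hi, Nat.mod_eq_of_lt hi, pow_zero, Matrix.one_mulVec]

lemma windowState_twistedSeq_zero {D n : ℕ} (β : Fin (n + 1) → Fin D) :
    (windowState (n + 1) (twistedSeq β) 0).ofLp = Pi.single β 1 := by
  ext α
  have h : ∀ i : Fin (n + 1), twistedSeq β (0 + i) (α i) = if α i = β i then 1 else 0 := by
    intro i
    rw [zero_add, twistedSeq_of_lt β i.2, Pi.single_apply]
  simp only [windowState, productState, h, Fintype.prod_ite_zero]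
  simp [Pi.single_apply, funext_iff]

/-- The bi-infinite word `ε'_m … ε'_1 ε_1 ε_2 …`, read from the symbol `ε'_m` on. -/
def readFrom {D : ℕ} (m : ℕ) (x : SymbolSpace D) (i : ℕ) : Fin D :=
  if i < m then x.1 (m - 1 - i) else x.2 (i - m)

/-- After k - ℓ steps the symbols of ε' have left on the left and re-entered on the right, each with
one factor F*; the symbols of ε are still untouched. -/
lemma coherentState_eq_windowState {D n l : ℕ} (hl : l ≤ n + 1) (x : SymbolSpace D) :
    coherentState (n + 1) l x =
      windowState (n + 1) (twistedSeq fun i : Fin (n + 1) => readFrom (n + 1 - l) x i)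
        (n + 1 - l) := by
  rw [coherentState, windowState]
  congr 1
  ext1 i
  split_ifs with h
  · have h1 : n + 1 - l + i < n + 1 := by omega
    rw [twistedSeq_of_lt _ h1]
    simp [readFrom]
  · have h1 : n + 1 - l + (i : ℕ) = (i - l) + (n + 1) := by omega
    have h2 : (i : ℕ) - l < n + 1 := by omega
    rw [h1, twistedSeq_add, twistedSeq_of_lt _ h2]
    have h3 : (i : ℕ) - l < n + 1 - l := by omega
    have h4 : n + 1 - l - 1 - ((i : ℕ) - l) = Fin.rev i := by
      rw [Fin.val_rev]; omega
    simp only [readFrom, h3, if_true, h4]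

/-- An amplitude changes only by a phase along the orbit of windows, so it may be computed at time
0, where the window is a basis state. -/
lemma IsEigenstate.norm_inner_coherentState {D n l : ℕ} [NeZero D] {ψ : State D (n + 1)}
    (hψ : IsEigenstate ψ) (hl : l ≤ n + 1) (x : SymbolSpace D) :
    ‖inner ℂ ψ (coherentState (n + 1) l x)‖ =
      ‖ψ.ofLp fun i => readFrom (n + 1 - l) x i‖ := by
  obtain ⟨z, hz1, hz⟩ := hψ.exists_amplitude
  have h := hz _ (twistedSeq_add fun i : Fin (n + 1) => readFrom (n + 1 - l) x i) (n + 1 - l)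
  rw [← coherentState_eq_windowState hl, windowState_twistedSeq_zero] at h
  have h2 := congrArg norm h
  rw [norm_mul, norm_pow, hz1, one_pow, one_mul] at h2
  rw [EuclideanSpace.inner_eq_star_dotProduct, dotProduct_comm, h2]
  simp

lemma IsEigenstate.norm_tensorPower_mulVec {D n : ℕ} [NeZero D] {ψ : State D (n + 1)}
    (hψ : IsEigenstate ψ) (β : Fin (n + 1) → Fin D) :
    ‖(tensorPower (Fin (n + 1)) (fourierMatrix D) *ᵥ ψ.ofLp) β‖ = ‖ψ.ofLp β‖ := by
  obtain ⟨z, hz1, hz⟩ := hψ.exists_amplitude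
  -- After a full period of n + 1 steps every slot carries exactly one F*, so the window is
  -- (F*)^{⊗(n+1)} e_β.
  have h := congrArg norm (hz _ (twistedSeq_add β) (n + 1))
  rw [windowState_twistedSeq_zero, norm_mul, norm_pow, hz1, one_pow, one_mul] at h
  have h2 : star ((tensorPower (Fin (n + 1)) (fourierMatrix D) *ᵥ ψ.ofLp) β) =
      star ψ.ofLp ⬝ᵥ (windowState (n + 1) (twistedSeq β) (n + 1)).ofLp := by
    have h3 : ∀ α : Fin (n + 1) → Fin D, (windowState (n + 1) (twistedSeq β) (n + 1)).ofLp α =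
        star (tensorPower (Fin (n + 1)) (fourierMatrix D) β α) := by
      intro α
      simp only [windowState, productState, tensorPower, Matrix.of_apply, star_prod]
      refine Finset.prod_congr rfl fun i _ => ?_
      rw [add_comm (n + 1), twistedSeq_add, twistedSeq_of_lt β i.2]
      simp
    simp only [Matrix.mulVec, dotProduct, star_sum, h3, star_mul, Pi.star_apply]
  rw [← norm_star, h2, h]
  simp

/-! ### The law of a word under an eigenstate -/

/-- A finite word, continued by zeros. -/
def extendWord {D k : ℕ} [NeZero D] (β : Fin k → Fin D) (i : ℕ) : Fin D :=
  if h : i < k then β ⟨i, h⟩ else 0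

open Classical in
/-- The probability that the word of a state lies in a set of sequences. -/
def wordProb {D k : ℕ} [NeZero D] (ψ : State D k) (E : Set (ℕ → Fin D)) : ℝ :=
  ∑ β : Fin k → Fin D, if extendWord β ∈ E then ‖ψ.ofLp β‖ ^ 2 else 0

/-- The set `E` of sequences is determined by the first `L` symbols. -/
def IsCylinder {D : ℕ} (L : ℕ) (E : Set (ℕ → Fin D)) : Prop :=
  ∀ x y : ℕ → Fin D, (∀ i < L, x i = y i) → x ∈ E → y ∈ E

lemma IsCylinder.mem_iff {D L : ℕ} {E : Set (ℕ → Fin D)} (hE : IsCylinder L E) {x y : ℕ → Fin D}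
    (h : ∀ i < L, x i = y i) : x ∈ E ↔ y ∈ E :=
  ⟨hE x y h, hE y x fun i hi => (h i hi).symm⟩

/-- The one-sided shift. -/
def seqShift {D : ℕ} (y : ℕ → Fin D) (i : ℕ) : Fin D := y (i + 1)

lemma IsCylinder.preimage_seqShift {D L : ℕ} {E : Set (ℕ → Fin D)} (hE : IsCylinder L E) :
    IsCylinder (L + 1) (seqShift ⁻¹' E) :=
  fun _ _ h hx => hE _ _ (fun i hi => h (i + 1) (by omega)) hx

lemma IsCylinder.preimage_iterate_seqShift {D L : ℕ} {E : Set (ℕ → Fin D)} (hE : IsCylinder L E)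
    (s : ℕ) : IsCylinder (L + s) (seqShift^[s] ⁻¹' E) := by
  induction s with
  | zero => exact hE
  | succ s ih =>
    rw [Function.iterate_succ, Set.preimage_comp]
    exact ih.preimage_seqShift

/-- The baker drops the first symbol and appends its transform at the end. The bound L ≤ n keeps the
last symbol out of sight of E, so it is summed freely, and F* preserves that sum of squares. -/
lemma IsEigenstate.wordProb_preimage_seqShift {D n L : ℕ} [NeZero D] {ψ : State D (n + 1)}
    (hψ : IsEigenstate ψ) {E : Set (ℕ → Fin D)} (hE : IsCylinder L E) (hL : L ≤ n) :
    wordProb ψ (seqShift ⁻¹' E) = wordProb ψ E := by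
  classical
  obtain ⟨z, hz1, hz⟩ := hψ.exists_eigenvalue
  rw [wordProb, wordProb, sum_cons, sum_snoc]
  refine Finset.sum_congr rfl fun r _ => ?_
  have hc : ∀ b, extendWord (Fin.cons (α := fun _ => Fin D) b r) ∈ seqShift ⁻¹' E ↔
      extendWord r ∈ E := by
    intro b
    have : seqShift (extendWord (Fin.cons (α := fun _ => Fin D) b r)) = extendWord r := by
      ext1 i
      simp only [seqShift, extendWord, Nat.add_lt_add_iff_right]
      split_ifs with h
      · exact Fin.cons_succ (α := fun _ => Fin D) b r ⟨i, h⟩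
      · rfl
    rw [Set.mem_preimage, this]
  have hs : ∀ a, extendWord (Fin.snoc (α := fun _ => Fin D) r a) ∈ E ↔ extendWord r ∈ E := by
    intro a
    refine hE.mem_iff fun i hi => ?_
    have h1 : i < n := by omega
    have h2 : i < n + 1 := by omega
    simp only [extendWord, h1, h2, dif_pos]
    exact Fin.snoc_castSucc (α := fun _ => Fin D) a r ⟨i, h1⟩
  simp only [hc, hs]
  split_ifs
  · have hU : ((fourierMatrix D)ᴴ)ᴴ * (fourierMatrix D)ᴴ = 1 := by
      rw [Matrix.conjTranspose_conjTranspose, fourierMatrix_mul_conjTranspose]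
    rw [← sum_norm_mulVec_sq hU fun b => ψ.ofLp (Fin.cons (α := fun _ => Fin D) b r)]
    refine Finset.sum_congr rfl fun a _ => ?_
    have h := congrFun hz (Fin.snoc (α := fun _ => Fin D) r a)
    rw [Matrix.mulVec, dotProduct, sum_cons, Finset.sum_eq_single r] at h
    · simp only [twistedShift, Matrix.of_apply, Fin.init_snoc, Fin.snoc_last, Fin.tail_cons,
        Fin.cons_zero, if_true, Pi.smul_apply, smul_eq_mul] at h
      rw [Matrix.mulVec, dotProduct, h, norm_mul, hz1, one_mul]
    · intro r' _ hr
      refine Finset.sum_eq_zero fun b _ => ?_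
      simp [twistedShift, hr.symm]
    · simp
  · simp

lemma IsEigenstate.wordProb_preimage_iterate {D k L s : ℕ} [NeZero D] {ψ : State D k}
    (hψ : IsEigenstate ψ) {E : Set (ℕ → Fin D)} (hE : IsCylinder L E) (hL : L + s ≤ k) :
    wordProb ψ (seqShift^[s] ⁻¹' E) = wordProb ψ E := by
  induction s with
  | zero => rfl
  | succ s ih =>
    obtain ⟨n, rfl⟩ : ∃ n, k = n + 1 := ⟨k - 1, by omega⟩
    rw [Function.iterate_succ, Set.preimage_comp,
      hψ.wordProb_preimage_seqShift (hE.preimage_iterate_seqShift s) (by omega), ih (by omega)]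

/-! ### Delocalization -/

lemma norm_add_sq_ge {x y : ℂ} {δ : ℝ} (hδ : 0 < δ) :
    (1 - δ) * ‖x‖ ^ 2 - δ⁻¹ * ‖y‖ ^ 2 ≤ ‖x + y‖ ^ 2 := by
  have h1 : (‖x‖ - ‖y‖) ^ 2 ≤ ‖x + y‖ ^ 2 := by
    have := abs_norm_sub_norm_le x (-y)
    rw [norm_neg, sub_neg_eq_add] at this
    rw [← sq_abs (‖x‖ - ‖y‖)]
    gcongr
  have h2 : 0 ≤ δ * (‖x‖ - δ⁻¹ * ‖y‖) ^ 2 := by positivity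
  have h3 : δ * (‖x‖ - δ⁻¹ * ‖y‖) ^ 2 = δ * ‖x‖ ^ 2 - 2 * ‖x‖ * ‖y‖ + δ⁻¹ * ‖y‖ ^ 2 := by
    field_simp
    ring
  nlinarith [sq_nonneg ‖y‖]

/-- One dominant term of flat weight c survives in the sum. Cauchy–Schwarz bounds the others, with
no loss in the number of terms since the weights sum to at most 1. -/
lemma norm_sum_mul_sq_ge {W : Type*} [Fintype W] [DecidableEq W] (u f : W → ℂ) {c : ℝ}
    (hu : ∀ w, ‖u w‖ ^ 2 = c) (hc : ∑ w, ‖u w‖ ^ 2 ≤ 1) (g : W) {δ : ℝ} (hδ : 0 < δ) :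
    (1 - δ) * (c * ‖f g‖ ^ 2) - δ⁻¹ * ∑ w ∈ Finset.univ.erase g, ‖f w‖ ^ 2 ≤
      ‖∑ w, u w * f w‖ ^ 2 := by
  rw [← Finset.add_sum_erase _ _ (Finset.mem_univ g)]
  refine le_trans ?_ (norm_add_sq_ge hδ)
  rw [norm_mul, mul_pow, hu]
  gcongr
  calc ‖∑ w ∈ Finset.univ.erase g, u w * f w‖ ^ 2
      ≤ (∑ w ∈ Finset.univ.erase g, ‖u w‖ * ‖f w‖) ^ 2 := by
        gcongr
        exact (norm_sum_le _ _).trans_eq (by simp only [norm_mul])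
    _ ≤ (∑ w ∈ Finset.univ.erase g, ‖u w‖ ^ 2) * ∑ w ∈ Finset.univ.erase g, ‖f w‖ ^ 2 :=
        Finset.sum_mul_sq_le_sq_mul_sq _ _ _
    _ ≤ 1 * ∑ w ∈ Finset.univ.erase g, ‖f w‖ ^ 2 := by
        gcongr
        refine le_trans ?_ hc
        exact Finset.sum_le_sum_of_subset_of_nonneg (Finset.erase_subset _ _)
          fun _ _ _ => by positivity
    _ = _ := one_mul _

lemma sum_norm_tensorPower_row {ι : Type*} [Fintype ι] [DecidableEq ι] {D : ℕ} [NeZero D]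
    (v : ι → Fin D) : ∑ w, ‖tensorPower ι (fourierMatrix D) v w‖ ^ 2 = 1 := by
  have h := congrFun (congrFun (congrArg (tensorPower ι) (fourierMatrix_mul_conjTranspose D)) v) v
  rw [← tensorPower_mul, ← tensorPower_conjTranspose, tensorPower_one, Matrix.one_apply_eq,
    Matrix.mul_apply] at h
  apply Complex.ofReal_injective
  push_cast
  rw [← h]
  refine Finset.sum_congr rfl fun w _ => ?_
  rw [Matrix.conjTranspose_apply, Complex.star_def, Complex.mul_conj']

lemma norm_tensorPower_sq {ι : Type*} [Fintype ι] {D : ℕ} [NeZero D]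
    (v w : ι → Fin D) :
    ‖tensorPower ι (fourierMatrix D) v w‖ ^ 2 = ((D : ℝ)⁻¹) ^ Fintype.card ι := by
  simp only [tensorPower, Matrix.of_apply, norm_prod, ← Finset.prod_pow, norm_fourierMatrix_sq,
    Finset.prod_const, Finset.card_univ]

/-- A state invariant in modulus under the Fourier transform of all slots: the law of a block
of slots is the law after a Fourier transform of this block alone. -/
lemma sum_norm_sq_block {ι : Type*} [Fintype ι] [DecidableEq ι] {D : ℕ} [NeZero D]
    (p : ι → Prop) [DecidablePred p] (ψ : (ι → Fin D) → ℂ)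
    (hψ : ∀ β, ‖(tensorPower ι (fourierMatrix D) *ᵥ ψ) β‖ = ‖ψ β‖) (v : {i // p i} → Fin D) :
    ∑ r : {i // ¬ p i} → Fin D,
        ‖ψ ((Equiv.piEquivPiSubtypeProd p fun _ => Fin D).symm (v, r))‖ ^ 2 =
      ∑ r : {i // ¬ p i} → Fin D, ‖∑ w, tensorPower {i // p i} (fourierMatrix D) v w *
        ψ ((Equiv.piEquivPiSubtypeProd p fun _ => Fin D).symm (w, r))‖ ^ 2 := by
  set e := Equiv.piEquivPiSubtypeProd p fun _ => Fin D with he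
  have hU : (tensorPower {i // ¬ p i} (fourierMatrix D))ᴴ *
      tensorPower {i // ¬ p i} (fourierMatrix D) = 1 := by
    rw [tensorPower_conjTranspose, tensorPower_mul, conjTranspose_mul_fourierMatrix,
      tensorPower_one]
  -- The transform of the complementary slots is inserted for free, since it is unitary in r;
  -- together with that of the block it makes up the full transform, to which `hψ` applies.
  rw [← sum_norm_mulVec_sq hU fun r => ∑ w, tensorPower {i // p i} (fourierMatrix D) v w *
        ψ (e.symm (w, r))]
  refine Finset.sum_congr rfl fun r' _ => ?_
  rw [← hψ]
  congr 2
  simp only [Matrix.mulVec, dotProduct]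
  rw [← Equiv.sum_comp e.symm, Fintype.sum_prod_type_right]
  refine Finset.sum_congr rfl fun r _ => ?_
  rw [Finset.mul_sum]
  refine Finset.sum_congr rfl fun w _ => ?_
  have hprod : tensorPower ι (fourierMatrix D) (e.symm (v, r')) (e.symm (w, r)) =
      tensorPower {i // p i} (fourierMatrix D) v w *
        tensorPower {i // ¬ p i} (fourierMatrix D) r' r := by
    simp only [tensorPower, Matrix.of_apply]
    rw [← Fintype.prod_subtype_mul_prod_subtype p]
    congr 1
    · refine Finset.prod_congr rfl fun i _ => ?_
      simp [he, Equiv.piEquivPiSubtypeProd, i.2]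
    · refine Finset.prod_congr rfl fun i _ => ?_
      simp [he, Equiv.piEquivPiSubtypeProd, i.2]
  rw [hprod]
  ring

/-- The sequences that carry the word of `m` symbols of `v` from the position `a` on. -/
def wordAt {D : ℕ} (a m : ℕ) (v : ℕ → Fin D) : Set (ℕ → Fin D) :=
  {y | ∀ i < m, y (a + i) = v i}

lemma card_block {k a m : ℕ} (h : a + m ≤ k) :
    Fintype.card {i : Fin k // a ≤ (i : ℕ) ∧ (i : ℕ) < a + m} = m := by
  have e : Fin m ≃ {i : Fin k // a ≤ (i : ℕ) ∧ (i : ℕ) < a + m} :=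
    { toFun := fun i => ⟨⟨a + i, by omega⟩, by simp⟩
      invFun := fun i => ⟨i.1 - a, by have := i.2; omega⟩
      left_inv := fun i => by simp
      right_inv := fun i => by
        have := i.2
        ext
        simp
        omega }
  rw [← Fintype.card_congr e, Fintype.card_fin]

/-- If the first `a` symbols of a word determine, on `S`, its `m` following symbols up to a small
probability, then these `m` symbols are delocalized. -/
lemma IsEigenstate.wordProb_wordAt_ge {D n a m : ℕ} [NeZero D] {ψ : State D (n + 1)}
    (hψ : IsEigenstate ψ) (ham : a + m ≤ n + 1) {S : Set (ℕ → Fin D)} (hS : IsCylinder a S)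
    (g : (ℕ → Fin D) → ℕ → Fin D) (hg : ∀ x y, (∀ i < a, x i = y i) → g x = g y)
    (v : ℕ → Fin D) {δ : ℝ} (hδ : 0 < δ) :
    (1 - δ) * (((D : ℝ)⁻¹) ^ m * wordProb ψ (S ∩ {y | y ∈ wordAt a m (g y)})) -
        δ⁻¹ * wordProb ψ (S ∩ {y | y ∉ wordAt a m (g y)}) ≤
      wordProb ψ (wordAt a m v) := by
  classical
  set p : Fin (n + 1) → Prop := fun i => a ≤ (i : ℕ) ∧ (i : ℕ) < a + m with hp
  set e := Equiv.piEquivPiSubtypeProd p fun _ => Fin D with he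
  have hpos : ∀ w r (i : Fin (n + 1)) (hi : p i), e.symm (w, r) i = w ⟨i, hi⟩ := by
    intro w r i hi
    simp [he, Equiv.piEquivPiSubtypeProd, hi]
  have hneg : ∀ w r (i : Fin (n + 1)) (hi : ¬ p i), e.symm (w, r) i = r ⟨i, hi⟩ := by
    intro w r i hi
    simp [he, Equiv.piEquivPiSubtypeProd, hi]
  have hagree : ∀ w w' r, ∀ i < a,
      extendWord (e.symm (w, r)) i = extendWord (e.symm (w', r)) i := by
    intro w w' r i hi
    have h1 : i < n + 1 := by omega
    have h2 : ¬ p ⟨i, h1⟩ := by simp only [hp]; omega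
    simp only [extendWord, h1, dif_pos]
    rw [hneg _ _ _ h2, hneg _ _ _ h2]
  have hword : ∀ (u : ℕ → Fin D) w r, extendWord (e.symm (w, r)) ∈ wordAt a m u ↔
      w = fun i => u (i.1 - a) := by
    intro u w r
    constructor
    · intro h
      ext1 ⟨i, hi⟩
      have h1 := h (i - a) (by have := hi.1; have := hi.2; omega)
      have h2 : a + ((i : ℕ) - a) = i := by have := hi.1; omega
      simp only [extendWord, h2, i.2, dif_pos] at h1
      rw [← h1]
      exact (hpos w r i hi).symm
    · rintro rfl i hi
      have h1 : a + i < n + 1 := by omega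
      have h2 : p ⟨a + i, h1⟩ := by simp only [hp]; omega
      simp only [extendWord, h1, dif_pos]
      rw [hpos _ _ _ h2]
      simp
  set v' : {i // p i} → Fin D := fun i => v (i.1 - a) with hv'
  set S' : Set ({i // ¬ p i} → Fin D) := {r | extendWord (e.symm (v', r)) ∈ S} with hS'
  -- Both S and g see only the first a symbols, all outside the block. They are thus functions of r
  -- alone, and v' is an arbitrary filling of the block.
  set g' : ({i // ¬ p i} → Fin D) → {i // p i} → Fin D :=
    fun r i => g (extendWord (e.symm (v', r))) (i.1 - a) with hg'
  have hmemS : ∀ w r, extendWord (e.symm (w, r)) ∈ S ↔ r ∈ S' := fun w r =>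
    hS.mem_iff (hagree w v' r)
  have hmemg : ∀ w r, extendWord (e.symm (w, r)) ∈ wordAt a m (g (extendWord (e.symm (w, r)))) ↔
      w = g' r := by
    intro w r
    rw [hg _ _ (hagree w v' r), hword]
  have hsum : ∀ E : Set (ℕ → Fin D), wordProb ψ E = ∑ r, ∑ w,
      if extendWord (e.symm (w, r)) ∈ E then ‖ψ.ofLp (e.symm (w, r))‖ ^ 2 else 0 := by
    intro E
    rw [wordProb, ← Equiv.sum_comp e.symm, Fintype.sum_prod_type_right]
  -- The uncertainty principle enters here: the mass of the word v is rewritten through the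
  -- transform of the block.
  have hR : wordProb ψ (wordAt a m v) = ∑ r, ‖∑ w, tensorPower {i // p i} (fourierMatrix D) v' w *
        ψ.ofLp (e.symm (w, r))‖ ^ 2 := by
    rw [hsum, ← sum_norm_sq_block p ψ.ofLp hψ.norm_tensorPower_mulVec v']
    refine Finset.sum_congr rfl fun r _ => ?_
    simp only [hword]
    rw [Finset.sum_ite_eq' Finset.univ v', if_pos (Finset.mem_univ _)]
  have hA : wordProb ψ (S ∩ {y | y ∈ wordAt a m (g y)}) =
      ∑ r, if r ∈ S' then ‖ψ.ofLp (e.symm (g' r, r))‖ ^ 2 else 0 := by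
    rw [hsum]
    refine Finset.sum_congr rfl fun r _ => ?_
    simp only [Set.mem_inter_iff, Set.mem_ofPred_eq, hmemS, hmemg]
    split_ifs with h
    · simp only [h, true_and]
      rw [Finset.sum_ite_eq' Finset.univ (g' r), if_pos (Finset.mem_univ _)]
    · simp [h]
  have hB : wordProb ψ (S ∩ {y | y ∉ wordAt a m (g y)}) =
      ∑ r, if r ∈ S' then ∑ w ∈ Finset.univ.erase (g' r), ‖ψ.ofLp (e.symm (w, r))‖ ^ 2
        else 0 := by
    rw [hsum]
    refine Finset.sum_congr rfl fun r _ => ?_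
    simp only [Set.mem_inter_iff, Set.mem_ofPred_eq, hmemS, hmemg]
    split_ifs with h
    · simp only [h, true_and]
      rw [← Finset.sum_filter]
      congr 1
      ext w
      simp
    · simp [h]
  rw [hR, hA, hB, Finset.mul_sum, Finset.mul_sum, Finset.mul_sum, ← Finset.sum_sub_distrib]
  -- For fixed r in S', the dominant word is g' r and the flat weight is c = D^{-m}; the other r
  -- contribute nonnegatively.
  refine Finset.sum_le_sum fun r _ => ?_
  split_ifs
  · refine norm_sum_mul_sq_ge _ (fun w => ψ.ofLp (e.symm (w, r))) (fun w => ?_)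
      (sum_norm_tensorPower_row v').le (g' r) hδ
    rw [norm_tensorPower_sq, card_block ham]
  · simp

/-! ### Comparison of measures on cylinders -/

/-- Two measures are compared on all sets as soon as they are compared on the fibers of a
refining sequence of maps to finite sets, whose fibers form a basis of neighbourhoods. -/
lemma measure_le_of_fibers {X : Type*} [TopologicalSpace X] [MeasurableSpace X] [BorelSpace X]
    [TopologicalSpace.PseudoMetrizableSpace X] {F : ℕ → Type*} [∀ n, Finite (F n)]
    (f : ∀ n, X → F n) (hmono : ∀ n x y, f (n + 1) x = f (n + 1) y → f n x = f n y)
    (hmeas : ∀ n w, MeasurableSet (f n ⁻¹' {w}))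
    (hbasis : ∀ U : Set X, IsOpen U → ∀ x ∈ U, ∃ n, f n ⁻¹' {f n x} ⊆ U)
    (ν μ : Measure X) [IsFiniteMeasure μ]
    (h : ∀ n w, ν (f n ⁻¹' {w}) ≤ μ (f n ⁻¹' {w})) : ν ≤ μ := by
  have hopen : ∀ U : Set X, IsOpen U → ν U ≤ μ U := by
    intro U hU
    set T : ∀ n, Set (F n) := fun n => {w | f n ⁻¹' {w} ⊆ U} with hT
    have hUn : ∀ n, f n ⁻¹' T n = ⋃ w ∈ T n, f n ⁻¹' {w} := by
      intro n
      ext x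
      simp
    have hsub : ∀ n, f n ⁻¹' T n ⊆ U := fun n x hx => hx rfl
    have hincr : Monotone fun n => f n ⁻¹' T n := by
      refine monotone_nat_of_le_succ fun n x hx y hy => hx ?_
      exact hmono n y x hy
    have hunion : U = ⋃ n, f n ⁻¹' T n := by
      refine Set.Subset.antisymm (fun x hx => ?_) (Set.iUnion_subset hsub)
      obtain ⟨n, hn⟩ := hbasis U hU x hx
      exact Set.mem_iUnion.mpr ⟨n, hn⟩
    rw [hunion, hincr.measure_iUnion, hincr.measure_iUnion]
    refine iSup_mono fun n => ?_
    have hdisj : (T n).PairwiseDisjoint fun w => f n ⁻¹' {w} :=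
      fun w _ w' _ hw => Disjoint.preimage _ (by simpa using hw)
    rw [hUn, measure_biUnion (T n).to_countable hdisj fun w _ => hmeas n w,
      measure_biUnion (T n).to_countable hdisj fun w _ => hmeas n w]
    exact ENNReal.tsum_le_tsum fun w => h n w
  rw [Measure.le_iff]
  intro A _
  -- Outer regularity is needed for μ only: open sets that nearly realize μ A already bound ν A.
  rw [Set.measure_eq_iInf_isOpen A μ]
  exact le_iInf₂ fun U hAU => le_iInf fun hU => (measure_mono hAU).trans (hopen U hU)

/-- The first `n` symbols of a sequence. -/
def firstSymbols {D : ℕ} (n : ℕ) (y : ℕ → Fin D) (i : Fin n) : Fin D := y i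

@[fun_prop]
lemma continuous_firstSymbols {D : ℕ} (n : ℕ) : Continuous (firstSymbols (D := D) n) := by
  unfold firstSymbols
  fun_prop

lemma firstSymbols_eq_iff {D n : ℕ} {x y : ℕ → Fin D} :
    firstSymbols n x = firstSymbols n y ↔ ∀ i < n, x i = y i := by
  simp [funext_iff, firstSymbols, Fin.forall_iff]

lemma measurableSet_firstSymbols_preimage {D n : ℕ} (T : Set (Fin n → Fin D)) :
    MeasurableSet (firstSymbols n ⁻¹' T) :=
  (continuous_firstSymbols n).measurable T.toFinite.measurableSet

lemma exists_firstSymbols_subset {D : ℕ} {U : Set (ℕ → Fin D)} (hU : IsOpen U) {x : ℕ → Fin D}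
    (hx : x ∈ U) : ∃ N, ∀ n ≥ N, firstSymbols n ⁻¹' {firstSymbols n x} ⊆ U := by
  obtain ⟨I, u, hu, hIU⟩ := isOpen_pi_iff.mp hU x hx
  refine ⟨I.sup id + 1, fun n hn y hy => hIU fun i hi => ?_⟩
  have h : i ≤ I.sup id := Finset.le_sup (f := id) hi
  rw [firstSymbols_eq_iff.mp hy i (by omega)]
  exact (hu i hi).2

lemma measure_le_of_firstSymbols {D : ℕ} {ν μ : Measure (ℕ → Fin D)} [IsFiniteMeasure μ]
    (h : ∀ n w, ν (firstSymbols n ⁻¹' {w}) ≤ μ (firstSymbols n ⁻¹' {w})) : ν ≤ μ := by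
  refine measure_le_of_fibers (fun n => firstSymbols n) (fun n x y hxy => ?_)
    (fun n w => measurableSet_firstSymbols_preimage _) (fun U hU x hx => ?_) ν μ h
  · rw [firstSymbols_eq_iff] at hxy ⊢
    exact fun i hi => hxy i (by omega)
  · obtain ⟨N, hN⟩ := exists_firstSymbols_subset hU hx
    exact ⟨N, hN N le_rfl⟩

lemma measure_eq_of_firstSymbols {D : ℕ} {ν μ : Measure (ℕ → Fin D)} [IsFiniteMeasure μ]
    [IsFiniteMeasure ν]
    (h : ∀ n w, ν (firstSymbols n ⁻¹' {w}) = μ (firstSymbols n ⁻¹' {w})) : ν = μ :=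
  le_antisymm (measure_le_of_firstSymbols fun n w => (h n w).le)
    (measure_le_of_firstSymbols fun n w => (h n w).ge)

/-! ### One-sided readings of two-sided points -/

@[fun_prop]
lemma continuous_readFrom {D : ℕ} (m : ℕ) : Continuous (readFrom (D := D) m) := by
  refine continuous_pi fun i => ?_
  unfold readFrom
  split_ifs <;> fun_prop

lemma seqShift_readFrom {D : ℕ} (m : ℕ) (x : SymbolSpace D) :
    seqShift (readFrom (m + 1) x) = readFrom m x := by
  ext1 i
  simp only [seqShift, readFrom, Nat.add_lt_add_iff_right, Nat.add_sub_add_right]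
  rw [show m + 1 - 1 - (i + 1) = m - 1 - i by omega]

lemma iterate_seqShift_readFrom {D : ℕ} (s m : ℕ) (x : SymbolSpace D) :
    seqShift^[s] (readFrom (m + s) x) = readFrom m x := by
  induction s with
  | zero => rfl
  | succ s ih => rw [Function.iterate_succ_apply, ← add_assoc, seqShift_readFrom, ih]

lemma firstSymbols_readFrom_eq_iff {D n : ℕ} {x y : SymbolSpace D} :
    firstSymbols (n + n) (readFrom n x) = firstSymbols (n + n) (readFrom n y) ↔
      firstSymbols n x.1 = firstSymbols n y.1 ∧ firstSymbols n x.2 = firstSymbols n y.2 := by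
  simp only [firstSymbols_eq_iff, readFrom]
  constructor
  · intro h
    refine ⟨fun i hi => ?_, fun i hi => ?_⟩
    · have := h (n - 1 - i) (by omega)
      rw [if_pos (by omega), if_pos (by omega), show n - 1 - (n - 1 - i) = i by omega] at this
      exact this
    · have := h (n + i) (by omega)
      rw [if_neg (by omega), if_neg (by omega), show n + i - n = i by omega] at this
      exact this
  · rintro ⟨h1, h2⟩ i hi
    split_ifs with h
    · exact h1 _ (by omega)
    · exact h2 _ (by omega)

/-- A symmetric two-sided cylinder with n symbols on each side is a one-sided cylinder of length 2n
after reading from ε'_n, so domination on Σ can be tested on one-sided images. -/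
lemma measure_le_of_readFrom {D : ℕ} {ν μ : Measure (SymbolSpace D)} [IsFiniteMeasure μ]
    (h : ∀ n, ν.map (readFrom n) ≤ μ.map (readFrom n)) : ν ≤ μ := by
  have hm : ∀ n, Measurable (readFrom (D := D) n) := fun n => (continuous_readFrom n).measurable
  refine measure_le_of_fibers (fun n x => firstSymbols (n + n) (readFrom n x))
    (fun n x y hxy => ?_) (fun n w => ?_) (fun U hU x hx => ?_) ν μ fun n w => ?_
  · rw [firstSymbols_readFrom_eq_iff, firstSymbols_eq_iff, firstSymbols_eq_iff] at hxy ⊢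
    exact ⟨fun i hi => hxy.1 i (by omega), fun i hi => hxy.2 i (by omega)⟩
  · exact hm n (measurableSet_firstSymbols_preimage {w})
  · obtain ⟨U₁, U₂, h₁, h₂, hx₁, hx₂, hsub⟩ := isOpen_prod_iff.mp hU x.1 x.2 hx
    obtain ⟨N₁, hN₁⟩ := exists_firstSymbols_subset h₁ hx₁
    obtain ⟨N₂, hN₂⟩ := exists_firstSymbols_subset h₂ hx₂
    refine ⟨max N₁ N₂, fun y hy => hsub ?_⟩
    obtain ⟨hy₁, hy₂⟩ := firstSymbols_readFrom_eq_iff.mp hy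
    exact ⟨hN₁ _ (le_max_left _ _) hy₁, hN₂ _ (le_max_right _ _) hy₂⟩
  · have h1 := Measure.le_iff'.mp (h n) (firstSymbols (n + n) ⁻¹' {w})
    rwa [Measure.map_apply (hm n) (measurableSet_firstSymbols_preimage _),
      Measure.map_apply (hm n) (measurableSet_firstSymbols_preimage _)] at h1

/-! ### The uniform measure on sequences -/

instance (D : ℕ) [NeZero D] : IsProbabilityMeasure (uniformSeq D) := by
  unfold uniformSeq
  infer_instance

instance (D : ℕ) [NeZero D] : IsProbabilityMeasure (symbolLebesgue D) := by
  unfold symbolLebesgue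
  infer_instance

lemma uniformSeq_finset (D : ℕ) [NeZero D] (s : Finset ℕ) (w : ℕ → Fin D) :
    uniformSeq D {y | ∀ i ∈ s, y i = w i} = ((D : ℝ≥0∞)⁻¹) ^ s.card := by
  have h : {y : ℕ → Fin D | ∀ i ∈ s, y i = w i} = (s : Set ℕ).pi fun i => {w i} := by
    ext y
    simp
  rw [h, uniformSeq, Measure.infinitePi_pi _ fun i _ => measurableSet_singleton _]
  simp

lemma uniformSeq_firstSymbols (D : ℕ) [NeZero D] (n : ℕ) (w : Fin n → Fin D) :
    uniformSeq D (firstSymbols n ⁻¹' {w}) = ((D : ℝ≥0∞)⁻¹) ^ n := by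
  have h := uniformSeq_finset D (Finset.range n) (extendWord w)
  rw [Finset.card_range] at h
  rw [← h]
  congr 1
  ext y
  simp only [Set.mem_preimage, Set.mem_singleton_iff, funext_iff, firstSymbols, Fin.forall_iff,
    Finset.mem_range, Set.mem_ofPred_eq]
  refine forall_congr' fun i => forall_congr' fun hi => ?_
  simp [extendWord, hi]

lemma map_readFrom_symbolLebesgue (D : ℕ) [NeZero D] (m : ℕ) :
    (symbolLebesgue D).map (readFrom m) = uniformSeq D := by
  have hm : Measurable (readFrom (D := D) m) := (continuous_readFrom m).measurable
  have := Measure.isProbabilityMeasure_map (μ := symbolLebesgue D) hm.aemeasurable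
  refine measure_eq_of_firstSymbols fun n w => ?_
  rw [Measure.map_apply hm (measurableSet_firstSymbols_preimage _), uniformSeq_firstSymbols]
  -- Of the first n symbols read, min m n come from ε', in reverse order, and the truncated n - m
  -- others from ε.
  set s₁ : Finset ℕ := (Finset.range (min m n)).image fun i => m - 1 - i with hs₁
  have hset : readFrom m ⁻¹' (firstSymbols n ⁻¹' {w}) =
      {y | ∀ i ∈ s₁, y i = extendWord w (m - 1 - i)} ×ˢ
        {y | ∀ i ∈ Finset.range (n - m), y i = extendWord w (i + m)} := by
    ext x
    simp only [Set.mem_preimage, Set.mem_singleton_iff, funext_iff, firstSymbols, Fin.forall_iff,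
      Set.mem_prod, Set.mem_ofPred_eq, hs₁, Finset.mem_image, Finset.mem_range,
      forall_exists_index, and_imp, lt_min_iff]
    constructor
    · intro h
      refine ⟨fun _ i hi hi' he => ?_, fun i hi => ?_⟩
      · subst he
        have := h i hi'
        rw [readFrom, if_pos hi] at this
        rw [this, show m - 1 - (m - 1 - i) = i by omega]
        simp [extendWord, hi']
      · have := h (i + m) (by omega)
        rw [readFrom, if_neg (by omega), Nat.add_sub_cancel] at this
        rw [this, extendWord, dif_pos]
    · rintro ⟨h1, h2⟩ i hi
      rw [readFrom]
      split_ifs with him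
      · rw [h1 _ i him hi rfl, show m - 1 - (m - 1 - i) = i by omega]
        simp [extendWord, hi]
      · rw [h2 (i - m) (by omega), show i - m + m = i by omega]
        simp [extendWord, hi]
  have hcard : s₁.card = min m n := by
    rw [hs₁, Finset.card_image_of_injOn, Finset.card_range]
    intro i hi j hj hij
    simp only [Finset.coe_range, Set.mem_Iio, lt_min_iff] at hi hj
    simp only at hij
    omega
  rw [hset, symbolLebesgue, Measure.prod_prod,
    uniformSeq_finset D s₁ fun i => extendWord w (m - 1 - i),
    uniformSeq_finset D _ fun i => extendWord w (i + m), hcard, Finset.card_range, ← pow_add]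
  congr 1
  omega

/-! ### Invariance and ergodicity of the Bernoulli shift -/

lemma measurable_seqShift {D : ℕ} : Measurable (seqShift (D := D)) := by
  unfold seqShift
  fun_prop

lemma measurePreserving_seqShift (D : ℕ) [NeZero D] :
    MeasurePreserving seqShift (uniformSeq D) (uniformSeq D) := by
  refine ⟨measurable_seqShift, ?_⟩
  conv_lhs => rw [← map_readFrom_symbolLebesgue D 1]
  rw [Measure.map_map measurable_seqShift (continuous_readFrom 1).measurable,
    show seqShift ∘ readFrom (D := D) 1 = readFrom 0 from funext (seqShift_readFrom 0),
    map_readFrom_symbolLebesgue]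

/-- An invariant set equals its preimage under every iterate of the shift, hence is a tail event,
and Kolmogorov's 0–1 law applies. -/
lemma ergodic_seqShift (D : ℕ) [NeZero D] : Ergodic seqShift (uniformSeq D) := by
  refine ⟨measurePreserving_seqShift D, ⟨fun t ht hinv => ?_⟩⟩
  rw [Filter.eventuallyConst_set']
  set σ : ℕ → MeasurableSpace (ℕ → Fin D) :=
    fun i => MeasurableSpace.comap (fun y => y i) inferInstance with hσ
  have hle : ∀ i, σ i ≤ MeasurableSpace.pi := fun i => (measurable_pi_apply i).comap_le
  have hindep : ProbabilityTheory.iIndep σ (uniformSeq D) :=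
    (ProbabilityTheory.iIndepFun_infinitePi
      (P := fun _ : ℕ => (PMF.uniformOfFintype (Fin D)).toMeasure)
      (X := fun _ => id) fun _ => measurable_id).iIndep
  have htail : MeasurableSet[limsup σ atTop] t := by
    rw [limsup_eq_iInf_iSup_of_nat, MeasurableSpace.measurableSet_iInf]
    intro n
    have hn : seqShift^[n] ⁻¹' t = t := by
      induction n with
      | zero => rfl
      | succ n ih => rw [Function.iterate_succ', Set.preimage_comp, hinv, ih]
    have hval : ∀ (n i : ℕ) (y : ℕ → Fin D), seqShift^[n] y i = y (i + n) := by
      intro n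
      induction n with
      | zero => intros; rfl
      | succ n ih =>
        intro i y
        rw [Function.iterate_succ_apply, ih, seqShift]
        rfl
    have hmeas : @Measurable _ _ (⨆ i, ⨆ _ : i ≥ n, σ i) MeasurableSpace.pi
        (seqShift^[n] : (ℕ → Fin D) → ℕ → Fin D) := by
      refine @measurable_pi_lambda _ _ _ (⨆ i, ⨆ _ : i ≥ n, σ i) _ _ fun i => ?_
      have h1 : σ (i + n) ≤ ⨆ i, ⨆ _ : i ≥ n, σ i :=
        le_iSup₂_of_le (i + n) (Nat.le_add_left n i) le_rfl
      have h2 : (fun y : ℕ → Fin D => seqShift^[n] y i) = fun y => y (i + n) :=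
        funext (hval n i)
      rw [h2]
      exact (comap_measurable _).mono h1 le_rfl
    rw [← hn]
    exact hmeas ht
  rcases ProbabilityTheory.measure_zero_or_one_of_measurableSet_limsup_atTop hle hindep htail with
    h | h
  · exact Or.inl (ae_eq_empty.mpr h)
  · exact Or.inr ((prob_compl_eq_zero_iff ht).mpr h |> fun h' => (ae_eq_univ.mpr h'))

/-! ### Husimi measures of cylinders -/

lemma IsCylinder.isClopen {D L : ℕ} {E : Set (ℕ → Fin D)} (hE : IsCylinder L E) : IsClopen E := by
  have h : E = firstSymbols L ⁻¹' (firstSymbols L '' E) := by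
    refine Set.Subset.antisymm (Set.subset_preimage_image _ _) ?_
    rintro y ⟨x, hx, hxy⟩
    exact hE x y (firstSymbols_eq_iff.mp hxy) hx
  rw [h]
  exact (isClopen_discrete _).preimage (continuous_firstSymbols L)

lemma IsCylinder.measurableSet {D L : ℕ} {E : Set (ℕ → Fin D)} (hE : IsCylinder L E) :
    MeasurableSet E :=
  hE.isClopen.isOpen.measurableSet

lemma IsCylinder.inter {D L L' : ℕ} {E E' : Set (ℕ → Fin D)} (hE : IsCylinder L E)
    (hE' : IsCylinder L' E') : IsCylinder (max L L') (E ∩ E') :=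
  fun _ _ h hx => ⟨hE _ _ (fun i hi => h i (lt_max_of_lt_left hi)) hx.1,
    hE' _ _ (fun i hi => h i (lt_max_of_lt_right hi)) hx.2⟩

lemma isCylinder_firstSymbols {D n : ℕ} (T : Set (Fin n → Fin D)) :
    IsCylinder n (firstSymbols n ⁻¹' T) := by
  intro x y h hx
  rw [Set.mem_preimage, ← firstSymbols_eq_iff.mpr h]
  exact hx

lemma wordProb_nonneg {D k : ℕ} [NeZero D] (ψ : State D k) (E : Set (ℕ → Fin D)) :
    0 ≤ wordProb ψ E := by
  refine Finset.sum_nonneg fun β _ => ?_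
  split_ifs <;> positivity

lemma wordProb_univ {D k : ℕ} [NeZero D] {ψ : State D k} (hψ : ‖ψ‖ = 1) :
    wordProb ψ Set.univ = 1 := by
  simp only [wordProb, Set.mem_univ, if_true]
  rw [← EuclideanSpace.norm_sq_eq, hψ, one_pow]

lemma lintegral_firstSymbols_uniformSeq {D : ℕ} [NeZero D] (k : ℕ)
    (F : (Fin k → Fin D) → ℝ≥0∞) :
    ∫⁻ y, F (firstSymbols k y) ∂uniformSeq D = ∑ β, F β * ((D : ℝ≥0∞)⁻¹) ^ k := by
  have hm : Measurable (firstSymbols (D := D) k) := (continuous_firstSymbols k).measurable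
  rw [← lintegral_map (measurable_of_finite F) hm, lintegral_fintype]
  refine Finset.sum_congr rfl fun β _ => ?_
  rw [Measure.map_apply hm (measurableSet_singleton β), uniformSeq_firstSymbols]

/-- The natural reading starts at ε'_{k-ℓ}. Starting at ε'_m instead skips s = k - ℓ - m symbols,
and shift invariance of the word law absorbs the skip, since L + s ≤ k. The result depends on
neither m nor ℓ. -/
lemma IsEigenstate.husimiMeasureSymbol_readFrom {D k l m L : ℕ} [NeZero D] {ψ : State D k}
    (hψ : IsEigenstate ψ) (hk : 1 ≤ k) (hm : m + l ≤ k) {E : Set (ℕ → Fin D)}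
    (hE : IsCylinder L E) (hL : L ≤ m + l) :
    husimiMeasureSymbol l ψ (readFrom m ⁻¹' E) = ENNReal.ofReal (wordProb ψ E) := by
  classical
  obtain ⟨n, rfl⟩ : ∃ n, k = n + 1 := ⟨k - 1, by omega⟩
  set s := n + 1 - l - m with hs
  have hE' := hE.preimage_iterate_seqShift s
  have hpre : readFrom m ⁻¹' E = readFrom (n + 1 - l) ⁻¹' (seqShift^[s] ⁻¹' E) := by
    ext x
    rw [Set.mem_preimage, Set.mem_preimage, Set.mem_preimage,
      show n + 1 - l = m + s by omega, iterate_seqShift_readFrom]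
  have hmeas : Measurable (readFrom (D := D) (n + 1 - l)) := (continuous_readFrom _).measurable
  have hF : Measurable fun y : ℕ → Fin D =>
      ENNReal.ofReal ((D : ℝ) ^ (n + 1) * ‖ψ.ofLp (firstSymbols (n + 1) y)‖ ^ 2) :=
    (measurable_of_finite fun β : Fin (n + 1) → Fin D =>
      ENNReal.ofReal ((D : ℝ) ^ (n + 1) * ‖ψ.ofLp β‖ ^ 2)).comp
      (continuous_firstSymbols (n + 1)).measurable
  set F : (Fin (n + 1) → Fin D) → ℝ≥0∞ := fun β => if extendWord β ∈ seqShift^[s] ⁻¹' E then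
    ENNReal.ofReal ((D : ℝ) ^ (n + 1) * ‖ψ.ofLp β‖ ^ 2) else 0 with hF'
  rw [husimiMeasureSymbol, withDensity_apply _ (hpre ▸ hmeas hE'.measurableSet), hpre]
  calc ∫⁻ x in readFrom (n + 1 - l) ⁻¹' (seqShift^[s] ⁻¹' E),
        ENNReal.ofReal (husimi l ψ x) ∂symbolLebesgue D
      = ∫⁻ x in readFrom (n + 1 - l) ⁻¹' (seqShift^[s] ⁻¹' E),
          ENNReal.ofReal ((D : ℝ) ^ (n + 1) *
            ‖ψ.ofLp (firstSymbols (n + 1) (readFrom (n + 1 - l) x))‖ ^ 2) ∂symbolLebesgue D := by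
        refine lintegral_congr fun x => ?_
        rw [husimi, hψ.norm_inner_coherentState (by omega)]
        rfl
    _ = ∫⁻ y in seqShift^[s] ⁻¹' E, ENNReal.ofReal ((D : ℝ) ^ (n + 1) *
            ‖ψ.ofLp (firstSymbols (n + 1) y)‖ ^ 2) ∂uniformSeq D := by
        rw [← map_readFrom_symbolLebesgue D (n + 1 - l),
          setLIntegral_map hE'.measurableSet hF hmeas]
    _ = ∫⁻ y, F (firstSymbols (n + 1) y) ∂uniformSeq D := by
        rw [← lintegral_indicator hE'.measurableSet]
        refine lintegral_congr fun y => ?_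
        have hiff : extendWord (firstSymbols (n + 1) y) ∈ seqShift^[s] ⁻¹' E ↔
            y ∈ seqShift^[s] ⁻¹' E := by
          refine hE'.mem_iff fun i hi => ?_
          have : i < n + 1 := by omega
          simp [extendWord, this, firstSymbols]
        simp only [Set.indicator_apply, hF', hiff]
    _ = ENNReal.ofReal (wordProb ψ (seqShift^[s] ⁻¹' E)) := by
        rw [lintegral_firstSymbols_uniformSeq, wordProb, ENNReal.ofReal_sum_of_nonneg
          fun β _ => by split_ifs <;> positivity]
        refine Finset.sum_congr rfl fun β _ => ?_
        simp only [hF']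
        split_ifs
        · rw [mul_comm ((D : ℝ) ^ (n + 1)), ENNReal.ofReal_mul (by positivity), mul_assoc,
            ENNReal.ofReal_pow (Nat.cast_nonneg D), ENNReal.ofReal_natCast, ← mul_pow,
            ENNReal.mul_inv_cancel (Nat.cast_ne_zero.mpr (NeZero.ne D)) (ENNReal.natCast_ne_top D),
            one_pow, mul_one]
        · simp
    _ = ENNReal.ofReal (wordProb ψ E) := by
        rw [hψ.wordProb_preimage_iterate hE (by omega)]

lemma IsEigenstate.isProbabilityMeasure_husimi {D k l : ℕ} [NeZero D] {ψ : State D k}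
    (hψ : IsEigenstate ψ) (hk : 1 ≤ k) (hl : l ≤ k) :
    IsProbabilityMeasure (husimiMeasureSymbol l ψ) := by
  constructor
  have huniv : IsCylinder 0 (Set.univ : Set (ℕ → Fin D)) := fun _ _ _ _ => Set.mem_univ _
  have h := hψ.husimiMeasureSymbol_readFrom (m := 0) (l := l) hk (by omega) huniv (by omega)
  rw [Set.preimage_univ] at h
  rw [h, wordProb_univ hψ.1, ENNReal.ofReal_one]

/-! ### Limits of Husimi measures -/

lemma tendsto_measureReal_of_isClopen {X : Type*} [TopologicalSpace X] [MeasurableSpace X]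
    [BorelSpace X] {𝓕 : Filter ℕ} {ν : ℕ → Measure X} {μ : Measure X}
    (h : ∀ f : C(X, ℝ), Tendsto (fun j => ∫ x, f x ∂(ν j)) 𝓕 (𝓝 (∫ x, f x ∂μ)))
    {A : Set X} (hA : IsClopen A) : Tendsto (fun j => (ν j).real A) 𝓕 (𝓝 (μ.real A)) := by
  classical
  have hc : Continuous (A.indicator fun _ => (1 : ℝ)) :=
    (IsClopen.continuous_indicator hA continuous_const)
  have := h ⟨_, hc⟩
  simpa [integral_indicator hA.isOpen.measurableSet] using this

/-- Cylinders are clopen, so weak convergence gives their masses. The filter is general because the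
torus case takes limits along an ultrafilter. -/
lemma IsSemiclassicalSequence.tendsto_wordProb {D : ℕ} [NeZero D] {k l : ℕ → ℕ}
    {ψ : ∀ j, State D (k j)} (hs : IsSemiclassicalSequence k l ψ) {𝓕 : Filter ℕ}
    (h𝓕 : 𝓕 ≤ atTop) {μ : Measure (SymbolSpace D)}
    (hμ : ∀ f : C(SymbolSpace D, ℝ),
      Tendsto (fun j => ∫ x, f x ∂(husimiMeasureSymbol (l j) (ψ j))) 𝓕 (𝓝 (∫ x, f x ∂μ)))
    (m : ℕ) {L : ℕ} {E : Set (ℕ → Fin D)} (hE : IsCylinder L E) :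
    Tendsto (fun j => wordProb (ψ j) E) 𝓕 (𝓝 (μ.real (readFrom m ⁻¹' E))) := by
  have h := tendsto_measureReal_of_isClopen hμ (hE.isClopen.preimage (continuous_readFrom m))
  refine h.congr' ?_
  filter_upwards [h𝓕 (hs.tendsto_l.eventually_ge_atTop (L + 1)),
    h𝓕 (hs.tendsto_sub.eventually_ge_atTop m)] with j hl hsub
  have hl : L + 1 ≤ l j := hl
  have hsub : m ≤ k j - l j := hsub
  have hle := hs.le j
  rw [Measure.real, (hs.eigenstate j).husimiMeasureSymbol_readFrom (by omega) (by omega) hE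
    (by omega), ENNReal.toReal_ofReal (wordProb_nonneg _ _)]

/-- This is the invariance of μ under the classical baker, in one-sided form: the approximating word
probabilities do not involve m. -/
lemma map_readFrom_eq {D : ℕ} [NeZero D] {k l : ℕ → ℕ} {ψ : ∀ j, State D (k j)}
    (hs : IsSemiclassicalSequence k l ψ) {𝓕 : Filter ℕ} [𝓕.NeBot] (h𝓕 : 𝓕 ≤ atTop)
    {μ : Measure (SymbolSpace D)} [IsProbabilityMeasure μ]
    (hμ : ∀ f : C(SymbolSpace D, ℝ),
      Tendsto (fun j => ∫ x, f x ∂(husimiMeasureSymbol (l j) (ψ j))) 𝓕 (𝓝 (∫ x, f x ∂μ)))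
    (m : ℕ) : μ.map (readFrom m) = μ.map (readFrom 0) := by
  have hm : ∀ m, Measurable (readFrom (D := D) m) := fun m => (continuous_readFrom m).measurable
  have hp : ∀ m, IsProbabilityMeasure (μ.map (readFrom m)) :=
    fun m => Measure.isProbabilityMeasure_map (hm m).aemeasurable
  refine measure_eq_of_firstSymbols fun n w => ?_
  have hcyl := isCylinder_firstSymbols {w}
  rw [Measure.map_apply (hm m) hcyl.measurableSet, Measure.map_apply (hm 0) hcyl.measurableSet]
  have h := tendsto_nhds_unique (hs.tendsto_wordProb h𝓕 hμ m hcyl)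
    (hs.tendsto_wordProb h𝓕 hμ 0 hcyl)
  exact (ENNReal.toReal_eq_toReal_iff' (measure_ne_top _ _) (measure_ne_top _ _)).mp h

lemma measurePreserving_seqShift_map_readFrom {D : ℕ} [NeZero D] {k l : ℕ → ℕ}
    {ψ : ∀ j, State D (k j)}
    (hs : IsSemiclassicalSequence k l ψ) {𝓕 : Filter ℕ} [𝓕.NeBot] (h𝓕 : 𝓕 ≤ atTop)
    {μ : Measure (SymbolSpace D)} [IsProbabilityMeasure μ]
    (hμ : ∀ f : C(SymbolSpace D, ℝ),
      Tendsto (fun j => ∫ x, f x ∂(husimiMeasureSymbol (l j) (ψ j))) 𝓕 (𝓝 (∫ x, f x ∂μ))) :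
    MeasurePreserving seqShift (μ.map (readFrom 0)) (μ.map (readFrom 0)) := by
  refine ⟨measurable_seqShift, ?_⟩
  conv_lhs => rw [← map_readFrom_eq hs h𝓕 hμ 1]
  rw [Measure.map_map measurable_seqShift (continuous_readFrom 1).measurable]
  congr 1

lemma map_readFrom_wordAt_ge {D : ℕ} [NeZero D] {k l : ℕ → ℕ} {ψ : ∀ j, State D (k j)}
    (hs : IsSemiclassicalSequence k l ψ) {𝓕 : Filter ℕ} [𝓕.NeBot] (h𝓕 : 𝓕 ≤ atTop)
    {μ : Measure (SymbolSpace D)}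
    (hμ : ∀ f : C(SymbolSpace D, ℝ),
      Tendsto (fun j => ∫ x, f x ∂(husimiMeasureSymbol (l j) (ψ j))) 𝓕 (𝓝 (∫ x, f x ∂μ)))
    {a m : ℕ} {S : Set (ℕ → Fin D)} (hS : IsCylinder a S)
    (g : (ℕ → Fin D) → ℕ → Fin D) (hg : ∀ x y, (∀ i < a, x i = y i) → g x = g y)
    (v : ℕ → Fin D) {δ : ℝ} (hδ : 0 < δ) :
    (1 - δ) * (((D : ℝ)⁻¹) ^ m *
        (μ.map (readFrom 0)).real (S ∩ {y | y ∈ wordAt a m (g y)})) -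
        δ⁻¹ * (μ.map (readFrom 0)).real (S ∩ {y | y ∉ wordAt a m (g y)}) ≤
      (μ.map (readFrom 0)).real (wordAt a m v) := by
  have hm0 : Measurable (readFrom (D := D) 0) := (continuous_readFrom 0).measurable
  have hlim : ∀ {L : ℕ} {E : Set (ℕ → Fin D)}, IsCylinder L E →
      Tendsto (fun j => wordProb (ψ j) E) 𝓕 (𝓝 ((μ.map (readFrom 0)).real E)) := by
    intro L E hE
    rw [Measure.real, Measure.map_apply hm0 hE.measurableSet]
    exact hs.tendsto_wordProb h𝓕 hμ 0 hE
  have hcyl : IsCylinder (a + m) {y : ℕ → Fin D | y ∈ wordAt a m (g y)} := by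
    intro x y h hx i hi
    rw [← h (a + i) (by omega), ← hg x y fun i hi => h i (by omega)]
    exact hx i hi
  have hcyl' : IsCylinder (a + m) {y : ℕ → Fin D | y ∉ wordAt a m (g y)} :=
    fun x y h hx hy => hx (hcyl y x (fun i hi => (h i hi).symm) hy)
  have hcylv : IsCylinder (a + m) (wordAt a m v) := by
    intro x y h hx i hi
    rw [← h (a + i) (by omega)]
    exact hx i hi
  refine le_of_tendsto_of_tendsto (((((hlim (hS.inter hcyl)).const_mul _).const_mul _)).sub
    ((hlim (hS.inter hcyl')).const_mul _)) (hlim hcylv) ?_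
  filter_upwards [h𝓕 (hs.strictMono.tendsto_atTop.eventually_ge_atTop (a + m + 1))] with j hj
  have hj : a + m + 1 ≤ k j := hj
  have hψ := hs.eigenstate j
  generalize ψ j = φ at hψ
  revert φ
  obtain ⟨n, hn⟩ : ∃ n, k j = n + 1 := ⟨k j - 1, by omega⟩
  rw [hn]
  intro φ hφ
  exact hφ.wordProb_wordAt_ge (by omega) hS g hg v hδ

/-! ### Atoms force a Lebesgue component -/

/-- The sequences that agree with an element of `C` up to time `a`. -/
def shadow {D : ℕ} (C : Finset (ℕ → Fin D)) (a : ℕ) : Set (ℕ → Fin D) :=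
  {y | ∃ c ∈ C, ∀ i < a, y i = c i}

lemma isCylinder_shadow {D : ℕ} (C : Finset (ℕ → Fin D)) (a : ℕ) : IsCylinder a (shadow C a) :=
  fun _ _ h ⟨c, hc, hx⟩ => ⟨c, hc, fun i hi => (h i hi).symm.trans (hx i hi)⟩

lemma eventually_eq_of_agree {D : ℕ} (C : Finset (ℕ → Fin D)) :
    ∀ᶠ a : ℕ in atTop, ∀ c ∈ C, ∀ c' ∈ C, (∀ i < a, c i = c' i) → c = c' := by
  refine (eventually_all_finset C).mpr fun c _ => (eventually_all_finset C).mpr fun c' _ => ?_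
  by_cases h : c = c'
  · exact Eventually.of_forall fun _ _ => h
  · obtain ⟨i, hi⟩ := Function.ne_iff.mp h
    filter_upwards [eventually_gt_atTop i] with a ha hagree
    exact absurd (hagree i ha) hi

lemma tendsto_measureReal_shadow {D : ℕ} (C : Finset (ℕ → Fin D)) (ρ : Measure (ℕ → Fin D))
    [IsFiniteMeasure ρ] : Tendsto (fun a => ρ.real (shadow C a)) atTop (𝓝 (ρ.real C)) := by
  have hanti : Antitone (shadow C) :=
    fun a b hab y ⟨c, hc, hy⟩ => ⟨c, hc, fun i hi => hy i (hi.trans_le hab)⟩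
  have hinter : ⋂ a, shadow C a = (C : Set (ℕ → Fin D)) := by
    refine Set.Subset.antisymm (fun y hy => ?_) fun y hy => Set.mem_iInter.mpr fun a =>
      ⟨y, hy, fun _ _ => rfl⟩
    by_contra hyC
    have : ∀ᶠ a : ℕ in atTop, ∀ c ∈ C, ¬ ∀ i < a, y i = c i := by
      refine (eventually_all_finset C).mpr fun c hc => ?_
      have hne : y ≠ c := by
        rintro rfl
        exact hyC hc
      obtain ⟨i, hi⟩ := Function.ne_iff.mp hne
      filter_upwards [eventually_gt_atTop i] with a ha hagree
      exact hi (hagree i ha)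
    obtain ⟨a, ha⟩ := this.exists
    obtain ⟨c, hc, hyc⟩ := Set.mem_iInter.mp hy a
    exact ha c hc hyc
  have h := tendsto_measure_iInter_atTop (μ := ρ) (s := shadow C)
    (fun a => (isCylinder_shadow C a).measurableSet.nullMeasurableSet) hanti
    ⟨0, measure_ne_top _ _⟩
  rw [hinter] at h
  exact (ENNReal.tendsto_toReal (measure_ne_top _ _)).comp h

/-- The symbols from time `a` on of an element of `C` that agrees with `y` up to time `a`. -/
def predicted {D : ℕ} [NeZero D] (C : Finset (ℕ → Fin D)) (a : ℕ) (y : ℕ → Fin D) : ℕ → Fin D :=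
  fun i => Classical.epsilon (fun c : ℕ → Fin D => c ∈ C ∧ ∀ i < a, y i = c i) (a + i)

lemma predicted_congr {D : ℕ} [NeZero D] (C : Finset (ℕ → Fin D)) (a : ℕ) (x y : ℕ → Fin D)
    (h : ∀ i < a, x i = y i) : predicted C a x = predicted C a y := by
  have hP : (fun c => c ∈ C ∧ ∀ i < a, x i = c i) = fun c => c ∈ C ∧ ∀ i < a, y i = c i := by
    ext c
    refine and_congr_right fun _ => forall_congr' fun i => forall_congr' fun hi => ?_
    rw [h i hi]
  unfold predicted
  rw [hP]

/-- Once a separates the elements of C, the choice in `predicted` has a single candidate, the c that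
y follows up to time a + m. -/
lemma mem_wordAt_predicted {D : ℕ} [NeZero D] {C : Finset (ℕ → Fin D)} {a m : ℕ}
    (ha : ∀ c ∈ C, ∀ c' ∈ C, (∀ i < a, c i = c' i) → c = c') {y : ℕ → Fin D}
    (hy : y ∈ shadow C (a + m)) : y ∈ wordAt a m (predicted C a y) := by
  obtain ⟨c, hc, hyc⟩ := hy
  have h : ∃ c ∈ C, ∀ i < a, y i = c i := ⟨c, hc, fun i hi => hyc i (by omega)⟩
  have hspec := Classical.epsilon_spec h
  have hcc := ha _ hspec.1 c hc fun i hi => (hspec.2 i hi).symm.trans (hyc i (by omega))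
  intro i hi
  rw [predicted, hcc]
  exact hyc (a + i) (by omega)

/-- A shift invariant measure on sequences such that, whenever the first `a` symbols predict the `m`
following ones on an event `S` up to an error of small mass, all words of length `m` carry almost
the uniform share of the mass of `S`. -/
structure IsDelocalized {D : ℕ} (ρ : Measure (ℕ → Fin D)) : Prop where
  measurePreserving : MeasurePreserving seqShift ρ ρ
  wordAt_ge : ∀ (a m : ℕ) (S : Set (ℕ → Fin D)), IsCylinder a S →
    ∀ g : (ℕ → Fin D) → ℕ → Fin D, (∀ x y, (∀ i < a, x i = y i) → g x = g y) →
    ∀ (v : ℕ → Fin D) (δ : ℝ), 0 < δ →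
    (1 - δ) * (((D : ℝ)⁻¹) ^ m * ρ.real (S ∩ {y | y ∈ wordAt a m (g y)})) -
        δ⁻¹ * ρ.real (S ∩ {y | y ∉ wordAt a m (g y)}) ≤ ρ.real (wordAt a m v)

namespace IsDelocalized
variable {D : ℕ} [NeZero D] {ρ : Measure (ℕ → Fin D)} [IsFiniteMeasure ρ]

/-- Delocalization is applied to S = `shadow C a`, with the next m symbols predicted by C. The
failures have mass at most ρ(S) - ρ(C), which tends to 0 as a grows. -/
lemma measureReal_finset_le (hρ : IsDelocalized ρ) (C : Finset (ℕ → Fin D)) (m : ℕ)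
    (v : ℕ → Fin D) : ((D : ℝ)⁻¹) ^ m * ρ.real C ≤ ρ.real (wordAt 0 m v) := by
  have hcyl : IsCylinder m (wordAt 0 m v) := by
    intro x y h hx i hi
    rw [← h (0 + i) (by omega)]
    exact hx i hi
  -- Invariance moves the block back to time 0, so the right-hand side stays fixed as a → ∞.
  have hinv : ∀ a, ρ.real (wordAt a m v) = ρ.real (wordAt 0 m v) := by
    intro a
    have hval : ∀ (a i : ℕ) (y : ℕ → Fin D), seqShift^[a] y i = y (a + i) := by
      intro a
      induction a with
      | zero => intro i y; simp
      | succ a ih =>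
        intro i y
        rw [Function.iterate_succ_apply, ih, seqShift]
        congr 1
        ring
    have hset : wordAt a m v = seqShift^[a] ⁻¹' wordAt 0 m v := by
      ext y
      simp [wordAt, hval]
    rw [Measure.real, hset, (hρ.measurePreserving.iterate a).measure_preimage
      hcyl.measurableSet.nullMeasurableSet, Measure.real]
  have hδ : ∀ δ : ℝ, 0 < δ → δ < 1 →
      (1 - δ) * (((D : ℝ)⁻¹) ^ m * ρ.real C) ≤ ρ.real (wordAt 0 m v) := by
    intro δ h0 h1
    -- The order of limits matters: a → ∞ with δ fixed removes the error with factor δ⁻¹, and only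
    -- then δ → 0.
    have hlim : Tendsto (fun a => (1 - δ) * (((D : ℝ)⁻¹) ^ m * ρ.real C) -
        δ⁻¹ * (ρ.real (shadow C a) - ρ.real C)) atTop
        (𝓝 ((1 - δ) * (((D : ℝ)⁻¹) ^ m * ρ.real C) - δ⁻¹ * (ρ.real C - ρ.real C))) :=
      tendsto_const_nhds.sub (((tendsto_measureReal_shadow C ρ).sub_const _).const_mul _)
    rw [sub_self, mul_zero, sub_zero] at hlim
    refine le_of_tendsto hlim ?_
    filter_upwards [eventually_eq_of_agree C] with a ha
    rw [← hinv a]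
    refine le_trans ?_ (hρ.wordAt_ge a m (shadow C a) (isCylinder_shadow C a) (predicted C a)
      (predicted_congr C a) v δ h0)
    have hsub : shadow C (a + m) ⊆ shadow C a :=
      fun y ⟨c, hc, hy⟩ => ⟨c, hc, fun i hi => hy i (by omega)⟩
    have hC : (C : Set (ℕ → Fin D)) ⊆ shadow C (a + m) := fun c hc => ⟨c, hc, fun _ _ => rfl⟩
    have hgood : ρ.real C ≤ ρ.real (shadow C a ∩ {y | y ∈ wordAt a m (predicted C a y)}) :=
      measureReal_mono fun c hc => ⟨hsub (hC hc), mem_wordAt_predicted ha (hC hc)⟩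
    have hbad : ρ.real (shadow C a ∩ {y | y ∉ wordAt a m (predicted C a y)}) ≤
        ρ.real (shadow C a) - ρ.real C := by
      rw [← measureReal_sdiff (hC.trans hsub) C.measurableSet]
      exact measureReal_mono fun y hy => ⟨hy.1, fun hyC => hy.2 (mem_wordAt_predicted ha (hC hyC))⟩
    have h1' : 0 ≤ 1 - δ := by linarith
    gcongr
  have hlim : Tendsto (fun δ : ℝ => (1 - δ) * (((D : ℝ)⁻¹) ^ m * ρ.real C)) (𝓝[>] 0)
      (𝓝 ((1 - 0) * (((D : ℝ)⁻¹) ^ m * ρ.real C))) :=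
    ((continuous_const.sub continuous_id).mul continuous_const).continuousWithinAt
  rw [sub_zero, one_mul] at hlim
  refine le_of_tendsto hlim ?_
  filter_upwards [Ioo_mem_nhdsGT one_pos] with δ hδ' using hδ δ hδ'.1 hδ'.2

lemma smul_finset_le (hρ : IsDelocalized ρ) (C : Finset (ℕ → Fin D)) :
    ρ C • uniformSeq D ≤ ρ := by
  refine measure_le_of_firstSymbols fun n w => ?_
  have hset : wordAt 0 n (extendWord w) = firstSymbols n ⁻¹' {w} := by
    ext y
    simp only [wordAt, Set.mem_preimage, Set.mem_singleton_iff, funext_iff, firstSymbols,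
      Fin.forall_iff, Set.mem_ofPred_eq]
    refine forall_congr' fun i => forall_congr' fun hi => ?_
    simp [extendWord, hi]
  have h := hρ.measureReal_finset_le C n (extendWord w)
  rw [hset] at h
  rw [Measure.smul_apply, uniformSeq_firstSymbols, smul_eq_mul]
  have h2 := ENNReal.ofReal_le_ofReal h
  rw [ENNReal.ofReal_mul (by positivity), ofReal_measureReal, ofReal_measureReal,
    ENNReal.ofReal_pow (by positivity), ENNReal.ofReal_inv_of_pos
      (Nat.cast_pos.mpr (NeZero.pos D)), ENNReal.ofReal_natCast] at h2
  rwa [mul_comm]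

lemma smul_countable_le (hρ : IsDelocalized ρ) {C : Set (ℕ → Fin D)} (hC : C.Countable) :
    ρ C • uniformSeq D ≤ ρ := by
  classical
  refine Measure.le_iff.mpr fun A _ => ?_
  have hsum : ρ C = ∑' c : C, ρ {(c : ℕ → Fin D)} := by
    conv_lhs => rw [← Set.biUnion_of_singleton C]
    exact measure_biUnion hC (Set.pairwiseDisjoint_fiber id C |>.mono fun _ => by simp)
      fun _ _ => measurableSet_singleton _
  rw [Measure.smul_apply, smul_eq_mul, hsum, ENNReal.tsum_eq_iSup_sum, ENNReal.iSup_mul]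
  refine iSup_le fun s => ?_
  have hs : ∑ c ∈ s, ρ {(c : ℕ → Fin D)} = ρ (s.image ((↑) : C → ℕ → Fin D)) := by
    rw [← sum_measure_singleton, Finset.sum_image fun _ _ _ _ h => Subtype.ext h]
  rw [hs]
  exact Measure.le_iff'.mp (hρ.smul_finset_le _) A

/-- The absolutely continuous part of an invariant measure is invariant, hence a constant multiple
of the ergodic measure. -/
lemma exists_eq_singular_add (hρ : IsDelocalized ρ) :
    ∃ (σ : Measure (ℕ → Fin D)) (c : ℝ≥0∞), σ ⟂ₘ uniformSeq D ∧ ρ = σ + c • uniformSeq D := by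
  have hac := hρ.measurePreserving.withDensity_rnDeriv (measurePreserving_seqShift D)
  obtain ⟨c, hc⟩ := (ergodic_seqShift D).eq_smul_of_absolutelyContinuous hac
    (withDensity_absolutelyContinuous _ _)
  refine ⟨ρ.singularPart (uniformSeq D), c, Measure.mutuallySingular_singularPart _ _, ?_⟩
  have := Measure.haveLebesgueDecomposition_of_sigmaFinite ρ (uniformSeq D)
  rw [← hc, Measure.singularPart_add_rnDeriv]

end IsDelocalized

/-- The properties of a measure of finite total mass that the decomposition theorem uses: its
absolutely continuous part is uniform, and is at least as large as its mass on any countable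
set. -/
structure IsBalanced {X : Type*} [MeasurableSpace X] (leb μ : Measure X) : Prop where
  smul_le : ∀ C : Set X, C.Countable → μ C • leb ≤ μ
  exists_eq : ∃ (σ : Measure X) (c : ℝ≥0∞), σ ⟂ₘ leb ∧ μ = σ + c • leb

lemma IsSemiclassicalSequence.isBalanced {D : ℕ} [NeZero D] {k l : ℕ → ℕ}
    {ψ : ∀ j, State D (k j)} (hs : IsSemiclassicalSequence k l ψ) {𝓕 : Filter ℕ} [𝓕.NeBot]
    (h𝓕 : 𝓕 ≤ atTop) {μ : Measure (SymbolSpace D)} [IsProbabilityMeasure μ]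
    (hμ : ∀ f : C(SymbolSpace D, ℝ),
      Tendsto (fun j => ∫ x, f x ∂(husimiMeasureSymbol (l j) (ψ j))) 𝓕 (𝓝 (∫ x, f x ∂μ))) :
    IsBalanced (symbolLebesgue D) μ := by
  have hm : ∀ m, Measurable (readFrom (D := D) m) := fun m => (continuous_readFrom m).measurable
  have hρ : IsDelocalized (μ.map (readFrom 0)) :=
    ⟨measurePreserving_seqShift_map_readFrom hs h𝓕 hμ,
      fun _ _ _ hS g hg v _ hδ => map_readFrom_wordAt_ge hs h𝓕 hμ hS g hg v hδ⟩
  -- All readings of μ have the same law, and so do those of Lebesgue measure, so a one-sided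
  -- domination lifts to Σ.
  have hlift : ∀ c : ℝ≥0∞, c • uniformSeq D ≤ μ.map (readFrom 0) → c • symbolLebesgue D ≤ μ := by
    intro c hc
    refine measure_le_of_readFrom fun n => ?_
    rw [Measure.map_smul, map_readFrom_symbolLebesgue, map_readFrom_eq hs h𝓕 hμ n]
    exact hc
  refine ⟨fun C hC => hlift _ ?_, ?_⟩
  · refine le_trans ?_ (hρ.smul_countable_le (hC.image (readFrom 0)))
    refine Measure.le_iff'.mpr fun A => ?_
    rw [Measure.smul_apply, Measure.smul_apply, smul_eq_mul, smul_eq_mul,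
      Measure.map_apply (hm 0) (hC.image _).measurableSet]
    gcongr
    exact Set.subset_preimage_image _ _
  · obtain ⟨σ, c, hσ, heq⟩ := hρ.exists_eq_singular_add
    have hle : c • uniformSeq D ≤ μ.map (readFrom 0) := by
      rw [heq]
      exact Measure.le_add_left le_rfl
    have hfin : IsFiniteMeasure (μ.map (readFrom (D := D) 0)) :=
      Measure.isFiniteMeasure_map μ _
    have hcfin : IsFiniteMeasure (c • uniformSeq D) := isFiniteMeasure_of_le _ hle
    have hclift := hlift c hle
    have hclfin : IsFiniteMeasure (c • symbolLebesgue D) := isFiniteMeasure_of_le _ hclift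
    have hadd : μ - c • symbolLebesgue D + c • symbolLebesgue D = μ :=
      Measure.sub_add_cancel_of_le hclift
    refine ⟨μ - c • symbolLebesgue D, c, ?_, hadd.symm⟩
    -- The remainder projects to σ, so the preimage of a set separating σ from `uniformSeq D`
    -- separates it from Lebesgue measure on Σ.
    have hmap : (μ - c • symbolLebesgue D).map (readFrom 0) = σ := by
      have h := congrArg (Measure.map (readFrom 0)) hadd
      rw [Measure.map_add _ _ (hm 0), Measure.map_smul, map_readFrom_symbolLebesgue, heq] at h
      exact (Measure.add_left_inj _ _ _).mp h
    obtain ⟨N, hN, hN1, hN2⟩ := hσ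
    refine ⟨readFrom 0 ⁻¹' N, hm 0 hN, ?_, ?_⟩
    · rw [← Measure.map_apply (hm 0) hN, hmap, hN1]
    · rw [← Set.preimage_compl, ← Measure.map_apply (hm 0) hN.compl, map_readFrom_symbolLebesgue,
        hN2]

/-! ### Decompositions of balanced measures -/

/-- A component of mass zero cannot be normalized; d then replaces it, with weight 0. -/
lemma exists_isProbabilityMeasure_smul_eq {X : Type*} [MeasurableSpace X] (m d : Measure X)
    [IsFiniteMeasure m] [IsProbabilityMeasure d] :
    ∃ m' : Measure X, IsProbabilityMeasure m' ∧ m = ENNReal.ofReal (m.real Set.univ) • m' ∧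
      (m' ≪ m ∨ m' = d) := by
  rcases eq_or_ne m 0 with rfl | hm
  · exact ⟨d, inferInstance, by simp, Or.inr rfl⟩
  · have h0 : m Set.univ ≠ 0 := by simpa using hm
    refine ⟨(m Set.univ)⁻¹ • m, ⟨?_⟩, ?_, Or.inl Measure.smul_absolutelyContinuous⟩
    · rw [Measure.smul_apply, smul_eq_mul, ENNReal.inv_mul_cancel h0 (measure_ne_top _ _)]
    · rw [ofReal_measureReal, smul_smul, ENNReal.mul_inv_cancel h0 (measure_ne_top _ _), one_smul]

namespace IsBalanced
variable {X : Type} [MeasurableSpace X] [MeasurableSingletonClass X] {leb μ : Measure X}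
  [IsProbabilityMeasure leb]

/-- The singular part σ is split into its atoms and the rest. The measure ρ serves only as the
singular continuous component when that rest vanishes. -/
lemma exists_decomposition [IsProbabilityMeasure μ] (h : IsBalanced leb μ) (ρ : Measure X)
    [IsProbabilityMeasure ρ]
    (hρ : ∀ x, ρ {x} = 0) (hρleb : ρ ⟂ₘ leb) :
    ∃ (μpp μsc : Measure X) (βpp βsc βLeb : ℝ), IsDecomposition leb μ μpp μsc βpp βsc βLeb := by
  obtain ⟨σ, c, hσ, heq⟩ := h.exists_eq
  have hσle : σ ≤ μ := by
    rw [heq]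
    exact Measure.le_add_right le_rfl
  have hσfin : IsFiniteMeasure σ := isFiniteMeasure_of_le μ hσle
  have huniv : σ Set.univ + c = 1 := by
    have := congrArg (fun m : Measure X => m Set.univ) heq
    simpa using this.symm
  have hc : c ≠ ∞ := by
    rintro rfl
    simp at huniv
  obtain ⟨x₀⟩ : Nonempty X := nonempty_of_isProbabilityMeasure μ
  set S : Set X := {x | 0 < σ {x}} with hS
  have hScount : S.Countable := Measure.countable_meas_pos_of_disjoint_iUnion
    (fun x => measurableSet_singleton x) fun x y hxy => by simpa [Function.onFun] using hxy
  have hSm := hScount.measurableSet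
  obtain ⟨μpp, hpp, hppeq, hppac⟩ :=
    exists_isProbabilityMeasure_smul_eq (σ.restrict S) (Measure.dirac x₀)
  obtain ⟨μsc, hsc, hsceq, hscac⟩ := exists_isProbabilityMeasure_smul_eq (σ.restrict Sᶜ) ρ
  refine ⟨μpp, μsc, (σ.restrict S).real Set.univ, (σ.restrict Sᶜ).real Set.univ, c.toReal,
    ⟨measureReal_nonneg, measureReal_nonneg, ENNReal.toReal_nonneg, ?_, hpp, hsc, ?_, ?_, ?_, ?_⟩⟩
  · rw [measureReal_restrict_apply_univ, measureReal_restrict_apply_univ,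
      measureReal_add_measureReal_compl hSm, Measure.real, ← ENNReal.toReal_add
        (measure_ne_top _ _) hc, huniv, ENNReal.toReal_one]
  · refine ⟨S ∪ {x₀}, hScount.union (Set.countable_singleton x₀), ?_⟩
    rcases hppac with hac | rfl
    · refine hac ?_
      rw [Measure.restrict_apply (hSm.union (measurableSet_singleton x₀)).compl]
      convert! measure_empty (μ := σ)
      ext x
      simp
    · simp
  · intro x
    rcases hscac with hac | rfl
    · refine hac ?_
      rw [Measure.restrict_apply (measurableSet_singleton x)]
      by_cases hx : x ∈ S
      · convert! measure_empty (μ := σ)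
        ext y
        simp only [Set.mem_inter_iff, Set.mem_singleton_iff, Set.mem_compl_iff,
          Set.mem_empty_iff_false, iff_false, not_and, not_not]
        rintro rfl
        exact hx
      · exact measure_mono_null Set.inter_subset_left (by simpa [hS] using hx)
    · exact hρ x
  · rcases hscac with hac | rfl
    · exact (hσ.mono Measure.restrict_le_self le_rfl).mono_ac hac Measure.AbsolutelyContinuous.rfl
    · exact hρleb
  · rw [← hppeq, ← hsceq, Measure.restrict_add_restrict_compl hSm, ENNReal.ofReal_toReal hc]
    exact heq

/-- Let S carry μpp and let T separate μsc from `leb`. On T \ S, which has full `leb` measure, μ has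
mass βLeb, while μ ≥ μ(S) · `leb` and μ(S) ≥ βpp. -/
lemma pp_le_leb (h : IsBalanced leb μ) (hleb : ∀ x, leb {x} = 0) {μpp μsc : Measure X}
    {βpp βsc βLeb : ℝ} (hd : IsDecomposition leb μ μpp μsc βpp βsc βLeb) : βpp ≤ βLeb := by
  obtain ⟨S, hS, hpp⟩ := hd.purePoint
  obtain ⟨T, hT, hsc, hlebT⟩ := hd.singular
  have := hd.prob_pp
  have := hd.prob_sc
  have hlebS : leb S = 0 := by
    rw [← Set.biUnion_of_singleton S, measure_biUnion_null_iff hS]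
    exact fun x _ => hleb x
  have hppS : μpp S = 1 := (prob_compl_eq_zero_iff hS.measurableSet).mp hpp
  have hlebA : leb (T \ S) = 1 := by
    rw [measure_sdiff_null hlebS]
    exact (prob_compl_eq_zero_iff hT).mp hlebT
  have hscA : μsc (T \ S) = 0 := measure_mono_null Set.sdiff_subset hsc
  have hppA : μpp (T \ S) = 0 := measure_mono_null (fun x hx => hx.2) hpp
  have hle := Measure.le_iff'.mp (h.smul_le S hS) (T \ S)
  have hμA : μ (T \ S) = ENNReal.ofReal βLeb := by
    rw [hd.eq]
    simp [hlebA, hscA, hppA]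
  have hμS : ENNReal.ofReal βpp ≤ μ S := by
    rw [hd.eq]
    simp [hppS, add_assoc]
  rw [Measure.smul_apply, hlebA, smul_eq_mul, mul_one, hμA] at hle
  exact (ENNReal.ofReal_le_ofReal_iff hd.leb_nonneg).mp (hμS.trans hle)

end IsBalanced

/-! ### The symbolic case -/

lemma uniformSeq_singleton {D : ℕ} [NeZero D] (hD : 2 ≤ D) (y : ℕ → Fin D) :
    uniformSeq D {y} = 0 := by
  have hlt : (D : ℝ≥0∞)⁻¹ < 1 := by
    rw [ENNReal.inv_lt_one]
    exact_mod_cast hD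
  refine le_antisymm (ge_of_tendsto' (ENNReal.tendsto_pow_atTop_nhds_zero_of_lt_one hlt)
    fun n => ?_) zero_le
  rw [← uniformSeq_firstSymbols D n (firstSymbols n y)]
  exact measure_mono fun x hx => by rw [Set.mem_singleton_iff.mp hx]; rfl

lemma prod_singleton_eq_zero {X Y : Type*} [MeasurableSpace X] [MeasurableSpace Y]
    (μ : Measure X) (ν : Measure Y) [SFinite ν] (hν : ∀ y, ν {y} = 0) (x : X × Y) :
    (μ.prod ν) {x} = 0 := by
  rw [← Prod.mk.eta (p := x), ← Set.singleton_prod_singleton, Measure.prod_prod, hν, mul_zero]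

lemma dirac_prod_mutuallySingular {X Y : Type*} [MeasurableSpace X] [MeasurableSingletonClass X]
    [MeasurableSpace Y] {μ : Measure X} (ν ν' : Measure Y) [SFinite ν] [SFinite ν']
    {x : X} (hx : μ {x} = 0) : (Measure.dirac x).prod ν ⟂ₘ μ.prod ν' := by
  refine ⟨({x} ×ˢ Set.univ)ᶜ, ((measurableSet_singleton x).prod MeasurableSet.univ).compl, ?_, ?_⟩
  · have : (({x} : Set X) ×ˢ (Set.univ : Set Y))ᶜ = {x}ᶜ ×ˢ Set.univ := by
      ext p
      simp
    rw [this, Measure.prod_prod]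
    simp
  · rw [compl_compl, Measure.prod_prod, hx, zero_mul]

lemma decomposition_of_isSemiclassicalMeasureSymbol {D : ℕ} [NeZero D] (hD : 2 ≤ D)
    {μ : Measure (SymbolSpace D)} (hμ : IsSemiclassicalMeasureSymbol D μ) :
    (∃ (μpp μsc : Measure (SymbolSpace D)) (βpp βsc βLeb : ℝ),
      IsDecomposition (symbolLebesgue D) μ μpp μsc βpp βsc βLeb) ∧
    ∀ (μpp μsc : Measure (SymbolSpace D)) (βpp βsc βLeb : ℝ),
      IsDecomposition (symbolLebesgue D) μ μpp μsc βpp βsc βLeb → βpp ≤ βLeb := by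
  obtain ⟨hprob, k, l, ψ, hs, hlim⟩ := hμ
  have hb := hs.isBalanced le_rfl hlim
  exact ⟨hb.exists_decomposition ((Measure.dirac 0).prod (uniformSeq D))
      (prod_singleton_eq_zero _ _ (uniformSeq_singleton hD))
      (dirac_prod_mutuallySingular _ _ (uniformSeq_singleton hD 0)),
    fun _ _ _ _ _ hd => hb.pp_le_leb
      (prod_singleton_eq_zero _ _ (uniformSeq_singleton hD)) hd⟩

/-! ### The coding of the circle -/

instance : IsProbabilityMeasure (volume : Measure UnitAddCircle) :=
  ⟨UnitAddCircle.measure_univ⟩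

instance : IsProbabilityMeasure (volume : Measure Torus) := by
  rw [Measure.volume_eq_prod]
  infer_instance

/-- The point `0.y₁y₂…` of the circle. -/
def circlePoint {D : ℕ} (y : ℕ → Fin D) : UnitAddCircle := (Real.ofDigits y : ℝ)

/-- The point `(0.ε₁ε₂…, 0.ε'₁ε'₂…)` of the torus coded by `ε' · ε`. -/
def torusPoint {D : ℕ} (x : SymbolSpace D) : Torus := (circlePoint x.2, circlePoint x.1)

lemma continuous_circlePoint {D : ℕ} : Continuous (circlePoint (D := D)) :=
  (AddCircle.continuous_mk' 1).comp Real.continuous_ofDigits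

lemma continuous_torusPoint {D : ℕ} : Continuous (torusPoint (D := D)) :=
  (continuous_circlePoint.comp continuous_snd).prodMk (continuous_circlePoint.comp continuous_fst)

lemma equivIco_mem_Ico (t : UnitAddCircle) :
    ((AddCircle.equivIco (1 : ℝ) 0 t : Set.Ico (0 : ℝ) (0 + 1)) : ℝ) ∈ Set.Ico (0 : ℝ) 1 := by
  have h := (AddCircle.equivIco (1 : ℝ) 0 t).2
  exact ⟨h.1, h.2.trans_eq (zero_add 1)⟩

lemma equivIco_coe {x : ℝ} (hx : x ∈ Set.Ico (0 : ℝ) 1) :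
    ((AddCircle.equivIco (1 : ℝ) 0 (x : UnitAddCircle) : Set.Ico (0 : ℝ) (0 + 1)) : ℝ) = x := by
  have h := AddCircle.coe_equivIco_mk_apply (1 : ℝ) x
  rw [div_one, mul_one, Int.fract_eq_self.mpr hx] at h
  exact h

lemma circlePoint_circleDigits {D : ℕ} [NeZero D] (hD : 2 ≤ D) (t : UnitAddCircle) :
    circlePoint (circleDigits D t) = t := by
  rw [circlePoint, circleDigits, Real.ofDigits_digits (by omega) (equivIco_mem_Ico t)]
  exact AddCircle.coe_equivIco

lemma torusPoint_torusCode {D : ℕ} [NeZero D] (hD : 2 ≤ D) (p : Torus) :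
    torusPoint (torusCode D p) = p := by
  simp only [torusPoint, torusCode, circlePoint_circleDigits hD]

lemma measurable_circleDigits (D : ℕ) [NeZero D] : Measurable (circleDigits D) := by
  refine measurable_pi_lambda _ fun i => ?_
  have h : Measurable fun t : UnitAddCircle =>
      ((AddCircle.equivIco (1 : ℝ) 0 t : Set.Ico (0 : ℝ) (0 + 1)) : ℝ) :=
    measurable_subtype_coe.comp (AddCircle.measurableEquivIco 1 0).measurable
  exact (measurable_from_nat (f := Fin.ofNat D)).comp
    (Nat.measurable_floor.comp (h.mul_const _))

lemma measurable_torusCode (D : ℕ) [NeZero D] : Measurable (torusCode D) :=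
  ((measurable_circleDigits D).comp measurable_snd).prodMk
    ((measurable_circleDigits D).comp measurable_fst)

lemma map_circleDigits_volume {D : ℕ} [NeZero D] (hD : 2 ≤ D) :
    (volume : Measure UnitAddCircle).map (circleDigits D) = uniformSeq D := by
  have hm := measurable_circleDigits D
  have := Measure.isProbabilityMeasure_map (μ := (volume : Measure UnitAddCircle)) hm.aemeasurable
  -- Two probability measures, one below the other, are equal; upper bounds on cylinders suffice,
  -- and interval endpoints need no care.
  refine Measure.eq_of_le_of_isProbabilityMeasure (measure_le_of_firstSymbols fun n w => ?_)
  have hA := measurableSet_firstSymbols_preimage {w}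
  rw [Measure.map_apply hm hA, uniformSeq_firstSymbols,
    ← (UnitAddCircle.measurePreserving_mk 0).measure_preimage (hm hA).nullMeasurableSet,
    Measure.restrict_apply ((UnitAddCircle.measurePreserving_mk 0).measurable (hm hA))]
  set c := ∑ i ∈ Finset.range n, Real.ofDigitsTerm (extendWord w) i with hc
  have hDpos : (0 : ℝ) < D := Nat.cast_pos.mpr (NeZero.pos D)
  -- The fundamental domain here is (0, 1] whereas digits use [0, 1); the point 1 is set aside as a
  -- null set.
  have hsub : (QuotientAddGroup.mk : ℝ → UnitAddCircle) ⁻¹'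
        (circleDigits D ⁻¹' (firstSymbols n ⁻¹' {w})) ∩ Set.Ioc (0 : ℝ) (0 + 1) ⊆
      Set.Icc c (c + ((D : ℝ) ^ n)⁻¹) ∪ {1} := by
    rintro x ⟨hx, hx0, hx1⟩
    rw [zero_add] at hx1
    rcases hx1.eq_or_lt with rfl | hx1
    · exact Or.inr rfl
    left
    have hxI : x ∈ Set.Ico (0 : ℝ) 1 := ⟨hx0.le, hx1⟩
    have hd : circleDigits D (x : UnitAddCircle) = Real.digits x D := by
      rw [circleDigits, equivIco_coe hxI]
    have hx' : firstSymbols n (circleDigits D (x : UnitAddCircle)) = w := hx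
    rw [hd] at hx'
    have h := Real.ofDigits_eq_sum_add_ofDigits (Real.digits x D) n
    have hsum : ∑ i ∈ Finset.range n, Real.ofDigitsTerm (Real.digits x D) i = c := by
      refine Finset.sum_congr rfl fun i hi => ?_
      have hi' : i < n := Finset.mem_range.mp hi
      have : Real.digits x D i = extendWord w i := by
        rw [extendWord, dif_pos hi', ← hx', firstSymbols]
      rw [Real.ofDigitsTerm, Real.ofDigitsTerm, this]
    rw [Real.ofDigits_digits (by omega) hxI, hsum] at h
    have h0 := Real.ofDigits_nonneg fun i => Real.digits x D (i + n)
    have h1 := Real.ofDigits_le_one fun i => Real.digits x D (i + n)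
    have hp : (0 : ℝ) ≤ ((D : ℝ) ^ n)⁻¹ := by positivity
    rw [h]
    exact ⟨le_add_of_nonneg_right (mul_nonneg hp h0),
      add_le_add_right (mul_le_of_le_one_right hp h1) c⟩
  refine (measure_mono hsub).trans ((measure_union_le _ _).trans ?_)
  rw [Real.volume_singleton, add_zero, Real.volume_Icc, add_sub_cancel_left,
    ENNReal.ofReal_inv_of_pos (by positivity), ENNReal.ofReal_pow hDpos.le,
    ENNReal.ofReal_natCast, ENNReal.inv_pow]

lemma map_torusCode_volume {D : ℕ} [NeZero D] (hD : 2 ≤ D) :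
    (volume : Measure Torus).map (torusCode D) = symbolLebesgue D := by
  have hm := measurable_circleDigits D
  have h : torusCode D = Prod.swap ∘ Prod.map (circleDigits D) (circleDigits D) := rfl
  rw [h, ← Measure.map_map measurable_swap (hm.prodMap hm), Measure.volume_eq_prod,
    ← Measure.map_prod_map _ _ hm hm, map_circleDigits_volume hD, Measure.prod_swap,
    symbolLebesgue]

lemma map_torusPoint_symbolLebesgue {D : ℕ} [NeZero D] (hD : 2 ≤ D) :
    (symbolLebesgue D).map torusPoint = (volume : Measure Torus) := by
  rw [← map_torusCode_volume hD, Measure.map_map continuous_torusPoint.measurable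
    (measurable_torusCode D),
    show torusPoint ∘ torusCode D = id from funext (torusPoint_torusCode hD), Measure.map_id]

lemma volume_circle_singleton (t : UnitAddCircle) : (volume : Measure UnitAddCircle) {t} = 0 := by
  have h := uniformSeq_singleton (D := 2) le_rfl (circleDigits 2 t)
  rw [← map_circleDigits_volume le_rfl, Measure.map_apply (measurable_circleDigits 2)
    (measurableSet_singleton _)] at h
  exact measure_mono_null (fun s hs => by rw [Set.mem_singleton_iff.mp hs]; rfl) h

/-- The sequences with a tail of maximal digits. -/
def maximalTail (D : ℕ) : Set (ℕ → Fin D) := {y | ∃ N, ∀ i ≥ N, (y i : ℕ) = D - 1}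

lemma countable_maximalTail (D : ℕ) : (maximalTail D).Countable := by
  have h : maximalTail D = ⋃ N : ℕ, {y : ℕ → Fin D | ∀ i ≥ N, (y i : ℕ) = D - 1} := by
    ext y
    simp [maximalTail]
  rw [h]
  refine Set.countable_iUnion fun N => ?_
  refine Set.countable_of_injective_of_countable_image (f := firstSymbols N) ?_
    (Set.toFinite _).countable
  intro x hx y hy hxy
  ext1 i
  rcases lt_or_ge i N with hi | hi
  · exact firstSymbols_eq_iff.mp hxy i hi
  · exact Fin.ext ((hx i hi).trans (hy i hi).symm)

lemma ofDigits_lt_one {D : ℕ} (hD : 2 ≤ D) {y : ℕ → Fin D} {i : ℕ} (hi : (y i : ℕ) ≠ D - 1) :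
    Real.ofDigits y < 1 := by
  rw [← Real.ofDigits_const_last_eq_one' (b := D) (by omega)]
  have hDpos : (0 : ℝ) < D := by exact_mod_cast (by omega : 0 < D)
  refine Summable.tsum_lt_tsum (i := i) (fun j => ?_) ?_ Real.summable_ofDigitsTerm
    Real.summable_ofDigitsTerm
  · simp only [Real.ofDigitsTerm]
    have : (y j : ℕ) ≤ D - 1 := by omega
    gcongr
  · simp only [Real.ofDigitsTerm]
    have : (y i : ℕ) < D - 1 := by omega
    gcongr

/-- The integer with digits `y₀ … y_{n-1}`. -/
def prefixNat {D : ℕ} (y : ℕ → Fin D) : ℕ → ℕ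
  | 0 => 0
  | n + 1 => D * prefixNat y n + y n

lemma pow_mul_sum_ofDigitsTerm {D : ℕ} (hD : 2 ≤ D) (y : ℕ → Fin D) (n : ℕ) :
    (D : ℝ) ^ n * ∑ i ∈ Finset.range n, Real.ofDigitsTerm y i = prefixNat y n := by
  have hDpos : (D : ℝ) ≠ 0 := by exact_mod_cast (by omega : D ≠ 0)
  induction n with
  | zero => simp [prefixNat]
  | succ n ih =>
    rw [Finset.sum_range_succ, prefixNat, mul_add, pow_succ', mul_assoc, ih, Real.ofDigitsTerm]
    push_cast
    field_simp
    ring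

/-- Without a tail of digits D - 1 every remainder is strictly less than 1, so the floors recover
the integer prefixes, and their residues mod D are the digits. -/
lemma digits_ofDigits {D : ℕ} [NeZero D] (hD : 2 ≤ D) {y : ℕ → Fin D} (hy : y ∉ maximalTail D) :
    Real.digits (Real.ofDigits y) D = y := by
  have hDpos : (0 : ℝ) < D := Nat.cast_pos.mpr (NeZero.pos D)
  have hfloor : ∀ n, ⌊Real.ofDigits y * (D : ℝ) ^ n⌋₊ = prefixNat y n := by
    intro n
    have h : ∃ i ≥ n, (y i : ℕ) ≠ D - 1 := by
      by_contra hcon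
      push Not at hcon
      exact hy ⟨n, hcon⟩
    obtain ⟨i, hin, hi⟩ := h
    have hlt : Real.ofDigits (fun j => y (j + n)) < 1 := by
      refine ofDigits_lt_one hD (i := i - n) ?_
      rwa [show i - n + n = i by omega]
    have heq : Real.ofDigits y * (D : ℝ) ^ n =
        prefixNat y n + Real.ofDigits fun j => y (j + n) := by
      rw [Real.ofDigits_eq_sum_add_ofDigits y n, ← pow_mul_sum_ofDigitsTerm hD]
      field_simp
    rw [heq, Nat.floor_eq_iff (add_nonneg (Nat.cast_nonneg _) (Real.ofDigits_nonneg _))]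
    exact ⟨le_add_of_nonneg_right (Real.ofDigits_nonneg _), by linarith⟩
  ext1 i
  rw [Real.digits, hfloor, prefixNat]
  ext
  rw [Fin.val_ofNat, Nat.mul_add_mod, Nat.mod_eq_of_lt (y i).2]

lemma circleDigits_circlePoint {D : ℕ} [NeZero D] (hD : 2 ≤ D) {y : ℕ → Fin D}
    (hy : y ∉ maximalTail D) : circleDigits D (circlePoint y) = y := by
  have h : ∃ i, (y i : ℕ) ≠ D - 1 := by
    by_contra hcon
    push Not at hcon
    exact hy ⟨0, fun i _ => hcon i⟩
  obtain ⟨i, hi⟩ := h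
  rw [circleDigits, circlePoint, equivIco_coe ⟨Real.ofDigits_nonneg y, ofDigits_lt_one hD hi⟩,
    digits_ofDigits hD hy]

/-- A crude bound suffices: apart from the countably many sequences with a maximal tail, only the
standard digit expansion can represent t. -/
lemma countable_preimage_circlePoint {D : ℕ} [NeZero D] (hD : 2 ≤ D) (t : UnitAddCircle) :
    (circlePoint (D := D) ⁻¹' {t}).Countable := by
  refine ((countable_maximalTail D).union (Set.countable_singleton (circleDigits D t))).mono ?_
  intro y hy
  by_cases h : y ∈ maximalTail D
  · exact Or.inl h
  · right
    rw [Set.mem_singleton_iff, ← circleDigits_circlePoint hD h, Set.mem_singleton_iff.mp hy]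

lemma countable_preimage_torusPoint {D : ℕ} [NeZero D] (hD : 2 ≤ D) {C : Set Torus}
    (hC : C.Countable) : (torusPoint (D := D) ⁻¹' C).Countable := by
  refine (hC.biUnion fun p _ => (countable_preimage_circlePoint (D := D) hD p.2).prod
    (countable_preimage_circlePoint (D := D) hD p.1)).mono fun x hx => ?_
  exact Set.mem_biUnion hx ⟨rfl, rfl⟩

/-- Balanced measures on the symbolic space project to balanced measures on the torus. -/
lemma IsBalanced.map_torusPoint {D : ℕ} [NeZero D] (hD : 2 ≤ D) {μ : Measure (SymbolSpace D)}
    (h : IsBalanced (symbolLebesgue D) μ) :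
    IsBalanced (volume : Measure Torus) (μ.map torusPoint) := by
  have hπ : Measurable (torusPoint (D := D)) := continuous_torusPoint.measurable
  refine ⟨fun C hC => ?_, ?_⟩
  · rw [Measure.map_apply hπ hC.measurableSet, ← map_torusPoint_symbolLebesgue hD,
      ← Measure.map_smul]
    exact Measure.map_mono (h.smul_le _ (countable_preimage_torusPoint hD hC)) hπ
  · obtain ⟨σ, c, ⟨N, hN, hσN, hlebN⟩, heq⟩ := h.exists_eq
    refine ⟨σ.map torusPoint, c, ?_, ?_⟩
    -- Coding inverts the projection off Z in each coordinate, and Z is countable; removing it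
    -- carries the separating set N over to the torus.
    · set Z : Set UnitAddCircle := circlePoint '' maximalTail D with hZ
      have hZc : Z.Countable := (countable_maximalTail D).image _
      have hZ0 : (volume : Measure UnitAddCircle) Z = 0 := by
        rw [← Set.biUnion_of_singleton Z, measure_biUnion_null_iff hZc]
        exact fun t _ => volume_circle_singleton t
      have hM : MeasurableSet (torusCode D ⁻¹' N ∩ Zᶜ ×ˢ Zᶜ) :=
        (measurable_torusCode D hN).inter
          (hZc.measurableSet.compl.prod hZc.measurableSet.compl)
      refine ⟨torusCode D ⁻¹' N ∩ Zᶜ ×ˢ Zᶜ, hM, ?_, ?_⟩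
      · rw [Measure.map_apply hπ hM]
        refine measure_mono_null (fun x hx => ?_) hσN
        obtain ⟨hxN, hx2, hx1⟩ := hx
        have h1 : x.1 ∉ maximalTail D := fun hx => hx1 ⟨_, hx, rfl⟩
        have h2 : x.2 ∉ maximalTail D := fun hx => hx2 ⟨_, hx, rfl⟩
        have hx : torusCode D (torusPoint x) = x := by
          rw [torusCode, torusPoint]
          simp only [circleDigits_circlePoint hD h1, circleDigits_circlePoint hD h2]
        rw [Set.mem_preimage, hx] at hxN
        exact hxN
      · have hsub : (torusCode D ⁻¹' N ∩ Zᶜ ×ˢ Zᶜ)ᶜ ⊆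
            torusCode D ⁻¹' Nᶜ ∪ (Z ×ˢ Set.univ ∪ Set.univ ×ˢ Z) := by
          intro p hp
          simp only [Set.mem_compl_iff, Set.mem_inter_iff, Set.mem_prod, Set.mem_preimage,
            Set.mem_union, Set.mem_univ, and_true, true_and] at hp ⊢
          tauto
        refine measure_mono_null hsub (measure_union_null ?_ (measure_union_null ?_ ?_))
        · rw [← Measure.map_apply (measurable_torusCode D) hN.compl, map_torusCode_volume hD, hlebN]
        · rw [Measure.volume_eq_prod, Measure.prod_prod, hZ0, zero_mul]
        · rw [Measure.volume_eq_prod, Measure.prod_prod, hZ0, mul_zero]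
    · rw [heq, Measure.map_add _ _ hπ, Measure.map_smul, map_torusPoint_symbolLebesgue hD]

/-! ### Husimi measures on the torus -/

lemma measurable_husimi {D k : ℕ} [NeZero D] (l : ℕ) (ψ : State D k) : Measurable (husimi l ψ) := by
  set G : (Fin k → Fin D) × (Fin k → Fin D) → ℝ :=
    fun p => husimi l ψ (extendWord p.1, extendWord p.2) with hG
  have h : husimi l ψ = fun x => G (firstSymbols k x.1, firstSymbols k x.2) := by
    ext x
    have hcoh : coherentState k l x =
        coherentState k l (extendWord (firstSymbols k x.1), extendWord (firstSymbols k x.2)) := by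
      simp only [coherentState]
      congr 1
      ext1 i
      have h1 := i.2
      have h2 := (Fin.rev i).2
      simp only [extendWord, firstSymbols, h1, h2, dif_pos]
    simp only [hG, husimi]
    rw [hcoh]
  rw [h]
  exact (measurable_of_finite G).comp
    (((continuous_firstSymbols k).measurable.comp measurable_fst).prodMk
      ((continuous_firstSymbols k).measurable.comp measurable_snd))

lemma husimiMeasureTorus_eq_map {D k : ℕ} [NeZero D] (hD : 2 ≤ D) (l : ℕ) (ψ : State D k) :
    husimiMeasureTorus l ψ = (husimiMeasureSymbol l ψ).map torusPoint := by
  have hκ := measurable_torusCode D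
  have hh : Measurable fun x => ENNReal.ofReal (husimi l ψ x) :=
    (measurable_husimi l ψ).ennreal_ofReal
  have h : (husimiMeasureTorus l ψ).map (torusCode D) = husimiMeasureSymbol l ψ := by
    ext A hA
    rw [Measure.map_apply hκ hA, husimiMeasureTorus, husimiMeasureSymbol,
      withDensity_apply _ (hκ hA), withDensity_apply _ hA, ← map_torusCode_volume hD,
      setLIntegral_map hA hh hκ]
  rw [← h, Measure.map_map continuous_torusPoint.measurable hκ,
    show torusPoint ∘ torusCode D = id from funext (torusPoint_torusCode hD), Measure.map_id]

/-- Semiclassical measures on the torus lift to limits of Husimi measures on the symbolic space. -/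
lemma IsSemiclassicalSequence.exists_lift {D : ℕ} [NeZero D] (hD : 2 ≤ D) {k l : ℕ → ℕ}
    {ψ : ∀ j, State D (k j)} (hs : IsSemiclassicalSequence k l ψ) {μ : Measure Torus}
    [IsProbabilityMeasure μ] (hμ : WeaklyConverges (fun j => husimiMeasureTorus (l j) (ψ j)) μ) :
    ∃ ν : Measure (SymbolSpace D), IsProbabilityMeasure ν ∧ μ = ν.map torusPoint ∧
      ∀ f : C(SymbolSpace D, ℝ), Tendsto (fun j => ∫ x, f x ∂(husimiMeasureSymbol (l j) (ψ j)))
        (hyperfilter ℕ : Filter ℕ) (𝓝 (∫ x, f x ∂ν)) := by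
  have hprob : ∀ j ≥ 1, IsProbabilityMeasure (husimiMeasureSymbol (l j) (ψ j)) := fun j hj =>
    (hs.eigenstate j).isProbabilityMeasure_husimi (hj.trans (hs.strictMono.id_le j)) (hs.le j)
  have hex : ∀ j, ∃ P : ProbabilityMeasure (SymbolSpace D),
      1 ≤ j → (P : Measure (SymbolSpace D)) = husimiMeasureSymbol (l j) (ψ j) := by
    intro j
    by_cases hj : 1 ≤ j
    -- At j = 0 the dimension index k may be 0, where the mass lemma is unavailable; Lebesgue
    -- measure is a filler that no limit sees.
    · exact ⟨⟨_, hprob j hj⟩, fun _ => rfl⟩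
    · exact ⟨⟨symbolLebesgue D, inferInstance⟩, fun h => absurd h hj⟩
  choose P hP using hex
  -- Probability measures on Σ form a compact space, so an ultrafilter gives a limit without
  -- extracting a subsequence.
  obtain ⟨ν, -, hν⟩ := isCompact_univ.ultrafilter_le_nhds ((hyperfilter ℕ).map P) (by simp)
  have hlim : ∀ f : C(SymbolSpace D, ℝ),
      Tendsto (fun j => ∫ x, f x ∂(husimiMeasureSymbol (l j) (ψ j)))
        (hyperfilter ℕ : Filter ℕ) (𝓝 (∫ x, f x ∂(ν : Measure (SymbolSpace D)))) := by
    intro f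
    have h := ProbabilityMeasure.tendsto_iff_forall_integral_tendsto.mp
      (show Tendsto P (hyperfilter ℕ : Filter ℕ) (𝓝 ν) from hν)
      (BoundedContinuousFunction.mkOfCompact f)
    refine h.congr' ?_
    filter_upwards [Nat.hyperfilter_le_atTop (eventually_ge_atTop 1)] with j hj
    rw [hP j hj]
    rfl
  have hπ : Measurable (torusPoint (D := D)) := continuous_torusPoint.measurable
  have hmapprob := Measure.isProbabilityMeasure_map (μ := (ν : Measure (SymbolSpace D)))
    hπ.aemeasurable
  refine ⟨ν, inferInstance, ext_of_forall_integral_eq_of_IsFiniteMeasure fun f => ?_, hlim⟩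
  have h1 := (hμ f.toContinuousMap).mono_left Nat.hyperfilter_le_atTop
  have h2 := hlim (f.toContinuousMap.comp ⟨torusPoint, continuous_torusPoint⟩)
  rw [integral_map hπ.aemeasurable f.continuous.aestronglyMeasurable]
  refine tendsto_nhds_unique h1 (h2.congr fun j => ?_)
  change _ = ∫ x, f x ∂(husimiMeasureTorus (l j) (ψ j))
  rw [husimiMeasureTorus_eq_map hD]
  exact (integral_map hπ.aemeasurable f.continuous.aestronglyMeasurable).symm

lemma decomposition_of_isSemiclassicalMeasureTorus {D : ℕ} [NeZero D] (hD : 2 ≤ D)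
    {μ : Measure Torus} (hμ : IsSemiclassicalMeasureTorus D μ) :
    (∃ (μpp μsc : Measure Torus) (βpp βsc βLeb : ℝ),
      IsDecomposition volume μ μpp μsc βpp βsc βLeb) ∧
    ∀ (μpp μsc : Measure Torus) (βpp βsc βLeb : ℝ),
      IsDecomposition volume μ μpp μsc βpp βsc βLeb → βpp ≤ βLeb := by
  obtain ⟨hprob, k, l, ψ, hs, hlim⟩ := hμ
  obtain ⟨ν, hν, rfl, hνlim⟩ := hs.exists_lift hD hlim
  have hb := (hs.isBalanced Nat.hyperfilter_le_atTop hνlim).map_torusPoint hD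
  exact ⟨hb.exists_decomposition ((Measure.dirac 0).prod volume)
      (prod_singleton_eq_zero _ _ volume_circle_singleton)
      (dirac_prod_mutuallySingular _ _ (volume_circle_singleton 0)),
    fun _ _ _ _ _ hd => hb.pp_le_leb
      (prod_singleton_eq_zero _ _ volume_circle_singleton) hd⟩

end WalshBaker

end

theorem theorem3 (D : ℕ) [NeZero D] (hD : 2 ≤ D) :
    (∀ μ : Measure WalshBaker.Torus, WalshBaker.IsSemiclassicalMeasureTorus D μ →
      (∃ (μpp μsc : Measure WalshBaker.Torus) (βpp βsc βLeb : ℝ),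
        WalshBaker.IsDecomposition volume μ μpp μsc βpp βsc βLeb) ∧
      ∀ (μpp μsc : Measure WalshBaker.Torus) (βpp βsc βLeb : ℝ),
        WalshBaker.IsDecomposition volume μ μpp μsc βpp βsc βLeb → βpp ≤ βLeb) ∧
    (∀ μ : Measure (WalshBaker.SymbolSpace D), WalshBaker.IsSemiclassicalMeasureSymbol D μ →
      (∃ (μpp μsc : Measure (WalshBaker.SymbolSpace D)) (βpp βsc βLeb : ℝ),
        WalshBaker.IsDecomposition (WalshBaker.symbolLebesgue D) μ μpp μsc βpp βsc βLeb) ∧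
      ∀ (μpp μsc : Measure (WalshBaker.SymbolSpace D)) (βpp βsc βLeb : ℝ),
        WalshBaker.IsDecomposition (WalshBaker.symbolLebesgue D) μ μpp μsc βpp βsc βLeb →
          βpp ≤ βLeb) :=
  ⟨fun _ hμ => WalshBaker.decomposition_of_isSemiclassicalMeasureTorus hD hμ,
    fun _ hμ => WalshBaker.decomposition_of_isSemiclassicalMeasureSymbol hD hμ⟩
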